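/- **Conventions.** Let $\mathcal H=\mathcal H^+\oplus\mathcal H^-$ be a $\mathbb Z_2$-graded complex Hilbert space. A bounded operator is *even* if it preserves $\mathcal H^\pm$. An unbounded operator $D$ is *odd* if $\operatorname{dom}D=(\operatorname{dom}D\cap\mathcal H^+)\oplus(\operatorname{dom}D\cap\mathcal H^-)$ and $D$ maps $\operatorname{dom}D\cap\mathcal H^\pm$ to $\mathcal H^\mp$; write $D^\pm$ for its restrictions. Let $\mathcal A$ be a unital involutive complex algebra with a unital $*$-representation on $\mathcal H$ by even bounded operators, and let $\sigma$ be an algebra automorphism of $\mathcal A$ with $\sigma(a)^*=\sigma^{-1}(a^*)$. Then $(\mathcal A,\mathcal H,D)_\sigma$ is a *twisted spectral triple* if $D$ is an odd selfadjoint operator such that $(D+i)^{-1}$ is compact and, for all $a\in\mathcal A$, $a(\operatorname{dom}D)\subset\operatorname{dom}D$ and $[D,a]_\sigma:=Da-\sigma(a)D$ is bounded. For $\sigma=\mathrm{id}$ this is an *ordinary spectral triple* $(\mathcal A,\mathcal H,D)$. For an algebra $\mathcal B$, represented on $\mathcal H$ by even bounded operators, with automorphism $\sigma$ such that $\mathcal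 B$ preserves $\operatorname{dom}D$ and $[D,b]_\sigma$ is bounded for all $b\in\mathcal B$, and an idempotent $e\in M_q(\mathcal B)$, let $D^\pm_{e,\sigma}:=\sigma(e)(D^\pm\otimes 1_q)$, a Fredholm operator from $e(\operatorname{dom}D^\pm)^q\subset e(\mathcal H^\pm)^q$ to $\sigma(e)(\mathcal H^\mp)^q$, and $\operatorname{ind}D_{e,\sigma}:=\frac12(\operatorname{ind}D^+_{e,\sigma}-\operatorname{ind}D^-_{e,\sigma})$. Let $\operatorname{ind}_{D,\sigma}:K_0(\mathcal B)\to\frac12\mathbb Z$ be the unique additive map with $\operatorname{ind}_{D,\sigma}[e]=\operatorname{ind}D_{e,\sigma}$, where $K_0(\mathcal B)$ is the algebraic $K_0$-group. Two twisted spectral triples $(\mathcal A_1,\mathcal H,D)_{\sigma_1}$ and $(\mathcal A_2,\mathcal H,D)_{\sigma_2}$ are *in Poincaré duality* if $\mathcal A_1$ and $\mathcal A_2$ commute in $\mathcal L(\mathcal H)$, $[[D,a_1]_{\sigma_1},a_2]_{\sigma_2}=0$ for all $a_j\in\mathcal A_j$, and the bilinear pairing $(K_0(\mathcal A_1)\otimes\mathbb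 Q)\times(K_0(\mathcal A_2)\otimes\mathbb Q)\to\mathbb Q$ obtained from $K_0(\mathcal A_1)\times K_0(\mathcal A_2)\to K_0(\mathcal A_1\otimes\mathcal A_2)$, $([e_1],[e_2])\mapsto[e_1\otimes e_2]$, followed by $\operatorname{ind}_{D,\sigma_1\otimes\sigma_2}$ (where $\mathcal A_1\otimes\mathcal A_2$ is the algebraic tensor product, acting by $a_1\otimes a_2\mapsto a_1a_2$), is nondegenerate on both sides. For ordinary spectral triples this is applied with $\sigma_1=\sigma_2=\mathrm{id}$. A *pseudo-inner twisting operator* for an ordinary spectral triple $(\mathcal A,\mathcal H,D)$ is an even positive invertible operator $\omega=\omega^+\oplus\omega^-\in\mathcal L(\mathcal H)$ with $\omega(\operatorname{dom}D)=\operatorname{dom}D$ for which there are commuting positive invertible elements $k^+,k^-\in\mathcal A$ (positive: selfadjoint and acting as a positive operator) such that $\omega^\pm a(\omega^\pm)^{-1}=k^\pm a(k^\pm)^{-1}$ on $\mathcal H^\pm$ for all $a\in\mathcal A$. **Proposition.** Let $(\mathcal A_1,\mathcal H,D)$ and $(\mathcal A_2,\mathcal H,D)$ be ordinary spectral triples in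 Poincaré duality, and let $\omega\in\mathcal L(\mathcal H)$ be a pseudo-inner twisting operator for both, with associated elements $k_j^\pm\in\mathcal A_j$, $j=1,2$. Set $D_\omega=\omega D\omega$ with $\operatorname{dom}D_\omega=\operatorname{dom}D$, $k_j=k_j^+k_j^-$ and $\sigma_j(a)=k_jak_j^{-1}$ for $a\in\mathcal A_j$. Then $(\mathcal A_1,\mathcal H,D_\omega)_{\sigma_1}$ and $(\mathcal A_2,\mathcal H,D_\omega)_{\sigma_2}$ are twisted spectral triples and are in Poincaré duality. -/

import Mathlib

open scoped TensorProduct Kronecker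

noncomputable section

namespace TwistedPD

/-! ### Algebraic `K`-theory `K₀` of a unital ring -/

section KTheory

/-- Algebraic Murray-von Neumann equivalence of square matrices over a ring: `e = u v` and
`f = v u` for some rectangular matrices `u`, `v`. -/
def MvN {A : Type*} [Ring A] {m n : Type*} [Fintype m] [Fintype n]
    (e : Matrix m m A) (f : Matrix n n A) : Prop :=
  ∃ (u : Matrix m n A) (v : Matrix n m A), u * v = e ∧ v * u = f

theorem MvN.symm {A : Type*} [Ring A] {m n : Type*} [Fintype m] [Fintype n]
    {e : Matrix m m A} {f : Matrix n n A} (h : MvN e f) : MvN f e := by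
  obtain ⟨u, v, h1, h2⟩ := h
  exact ⟨v, u, h2, h1⟩

theorem MvN.refl {A : Type*} [Ring A] {m : Type*} [Fintype m]
    {e : Matrix m m A} (he : e * e = e) : MvN e e := ⟨e, e, he, he⟩

theorem MvN.trans {A : Type*} [Ring A] {m n p : Type*} [Fintype m] [Fintype n] [Fintype p]
    {e : Matrix m m A} {f : Matrix n n A} {g : Matrix p p A} (he : e * e = e) (hg : g * g = g)
    (h : MvN e f) (h' : MvN f g) : MvN e g := by
  obtain ⟨u, v, h1, h2⟩ := h
  obtain ⟨u', v', h3, h4⟩ := h'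
  refine ⟨u * u', v' * v, ?_, ?_⟩
  · calc u * u' * (v' * v) = u * (u' * v') * v := by simp only [Matrix.mul_assoc]
      _ = (u * v) * (u * v) := by rw [h3, ← h2]; simp only [Matrix.mul_assoc]
      _ = e := by rw [h1, he]
  · calc v' * v * (u * u') = v' * (v * u) * u' := by simp only [Matrix.mul_assoc]
      _ = (v' * u') * (v' * u') := by rw [h2, ← h3]; simp only [Matrix.mul_assoc]
      _ = g := by rw [h4, hg]

theorem MvN.reindex {A : Type*} [Ring A] {m n : Type*} [Fintype m] [Fintype n]
    {e : Matrix m m A} (he : e * e = e) (φ : m ≃ n) : MvN e (Matrix.reindex φ φ e) := by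
  refine ⟨e.submatrix id φ.symm, e.submatrix φ.symm id, ?_, ?_⟩
  · rw [Matrix.submatrix_mul_equiv e e id φ.symm id, he, Matrix.submatrix_id_id]
  · have := Matrix.submatrix_mul_equiv e e φ.symm (Equiv.refl m) φ.symm
    simpa [he] using this

theorem MvN.fromBlocks {A : Type*} [Ring A] {m n m' n' : Type*} [Fintype m] [Fintype n]
    [Fintype m'] [Fintype n'] {e : Matrix m m A} {f : Matrix n n A} {e' : Matrix m' m' A}
    {f' : Matrix n' n' A} (h : MvN e f) (h' : MvN e' f') :
    MvN (Matrix.fromBlocks e 0 0 e') (Matrix.fromBlocks f 0 0 f') := by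
  obtain ⟨u, v, h1, h2⟩ := h
  obtain ⟨u', v', h3, h4⟩ := h'
  refine ⟨Matrix.fromBlocks u 0 0 u', Matrix.fromBlocks v 0 0 v', ?_, ?_⟩ <;>
    simp [Matrix.fromBlocks_multiply, *]

theorem MvN.kronecker {A₁ A₂ : Type*} [Ring A₁] [Algebra ℂ A₁] [Ring A₂] [Algebra ℂ A₂]
    {m n m' n' : Type*} [Fintype m] [Fintype n]
    [Fintype m'] [Fintype n'] {e : Matrix m m A₁} {f : Matrix n n A₁} {e' : Matrix m' m' A₂}
    {f' : Matrix n' n' A₂} (h : MvN e f) (h' : MvN e' f') :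
    MvN (e ⊗ₖₜ[ℂ] e') (f ⊗ₖₜ[ℂ] f') := by
  obtain ⟨u, v, h1, h2⟩ := h
  obtain ⟨u', v', h3, h4⟩ := h'
  exact ⟨u ⊗ₖₜ[ℂ] u', v ⊗ₖₜ[ℂ] v', by rw [← Matrix.mul_kroneckerTMul_mul, h1, h3],
    by rw [← Matrix.mul_kroneckerTMul_mul, h2, h4]⟩

/-- An idempotent in `M_q(A)` for some `q`. -/
structure IdemMat (A : Type*) [Ring A] where
  size : ℕ
  mat : Matrix (Fin size) (Fin size) A
  idem : mat * mat = mat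

instance idemSetoid (A : Type*) [Ring A] : Setoid (IdemMat A) where
  r e f := MvN e.mat f.mat
  iseqv := ⟨fun e => MvN.refl e.idem, fun h => h.symm, fun {e _ g} h h' => h.trans e.idem g.idem h'⟩

/-- The zero idempotent (of size `0`). -/
def IdemMat.zero (A : Type*) [Ring A] : IdemMat A := ⟨0, 0, by simp⟩

/-- The direct sum `e ⊕ f` of two idempotents. -/
def IdemMat.directSum {A : Type*} [Ring A] (e f : IdemMat A) : IdemMat A where
  size := e.size + f.size
  mat := Matrix.reindex finSumFinEquiv finSumFinEquiv (Matrix.fromBlocks e.mat 0 0 f.mat)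
  idem := by
    simp only [Matrix.reindex_apply]
    rw [Matrix.submatrix_mul_equiv, Matrix.fromBlocks_multiply]
    simp [e.idem, f.idem]

/-- The idempotent `e₁ ⊗ e₂ ∈ M_{q₁q₂}(A₁ ⊗ A₂)`. -/
def IdemMat.tensor {A₁ A₂ : Type*} [Ring A₁] [Algebra ℂ A₁] [Ring A₂] [Algebra ℂ A₂]
    (e : IdemMat A₁) (f : IdemMat A₂) : IdemMat (A₁ ⊗[ℂ] A₂) where
  size := e.size * f.size
  mat := Matrix.reindex finProdFinEquiv finProdFinEquiv (e.mat ⊗ₖₜ[ℂ] f.mat)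
  idem := by
    simp only [Matrix.reindex_apply]
    rw [Matrix.submatrix_mul_equiv, ← Matrix.mul_kroneckerTMul_mul, e.idem, f.idem]

theorem IdemMat.blocks_idem {A : Type*} [Ring A] (e f : IdemMat A) :
    Matrix.fromBlocks e.mat 0 0 f.mat * Matrix.fromBlocks e.mat 0 0 f.mat =
      Matrix.fromBlocks e.mat 0 0 f.mat := by
  simp [Matrix.fromBlocks_multiply, e.idem, f.idem]

theorem IdemMat.directSum_mvn {A : Type*} [Ring A] (e f : IdemMat A) :
    MvN (Matrix.fromBlocks e.mat 0 0 f.mat) (e.directSum f).mat :=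
  MvN.reindex (e.blocks_idem f) _

theorem IdemMat.kron_idem {A₁ A₂ : Type*} [Ring A₁] [Algebra ℂ A₁] [Ring A₂] [Algebra ℂ A₂]
    (e : IdemMat A₁) (f : IdemMat A₂) :
    (e.mat ⊗ₖₜ[ℂ] f.mat) * (e.mat ⊗ₖₜ[ℂ] f.mat) = e.mat ⊗ₖₜ[ℂ] f.mat := by
  rw [← Matrix.mul_kroneckerTMul_mul, e.idem, f.idem]

theorem IdemMat.tensor_mvn {A₁ A₂ : Type*} [Ring A₁] [Algebra ℂ A₁] [Ring A₂] [Algebra ℂ A₂]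
    (e : IdemMat A₁) (f : IdemMat A₂) :
    MvN (e.mat ⊗ₖₜ[ℂ] f.mat) (e.tensor f).mat :=
  MvN.reindex (e.kron_idem f) _

/-- The monoid `V(A)` of equivalence classes of idempotent matrices over `A`. -/
def V (A : Type*) [Ring A] : Type _ := Quotient (idemSetoid A)

/-- The class of an idempotent in `V(A)`. -/
def V.mk {A : Type*} [Ring A] (e : IdemMat A) : V A := Quotient.mk _ e

theorem V.sound {A : Type*} [Ring A] {e f : IdemMat A} (h : MvN e.mat f.mat) :
    V.mk e = V.mk f := Quotient.sound h

theorem directSum_congr {A : Type*} [Ring A] {e e' f f' : IdemMat A} (h : MvN e.mat e'.mat)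
    (h' : MvN f.mat f'.mat) : MvN (e.directSum f).mat (e'.directSum f').mat :=
  ((e.directSum_mvn f).symm.trans (e.directSum f).idem (e'.blocks_idem f')
    (h.fromBlocks h')).trans (e.directSum f).idem (e'.directSum f').idem (e'.directSum_mvn f')

instance V.instZero (A : Type*) [Ring A] : Zero (V A) := ⟨V.mk (IdemMat.zero A)⟩

/-- Addition on `V(A)` is induced by the direct sum of idempotents. -/
instance V.instAdd (A : Type*) [Ring A] : Add (V A) :=
  ⟨Quotient.map₂ IdemMat.directSum fun _ _ h _ _ h' => directSum_congr h h'⟩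

instance V.instAddCommMonoid (A : Type*) [Ring A] : AddCommMonoid (V A) where
  zero_add := by
    rintro ⟨e⟩
    refine V.sound ?_
    refine ((IdemMat.directSum_mvn _ _).symm).trans (IdemMat.directSum _ _).idem e.idem ?_
    refine ⟨Matrix.of fun i j => Sum.elim (fun _ => 0) (fun i => e.mat i j) i,
      Matrix.of fun i j => Sum.elim (fun _ => 0) (fun j => e.mat i j) j, ?_, ?_⟩
    · ext (i | i) (j | j)
      · exact i.elim0
      · exact i.elim0
      · exact j.elim0
      · simpa [Matrix.mul_apply] using congrFun (congrFun e.idem i) j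
    · ext i j
      simpa [Matrix.mul_apply] using congrFun (congrFun e.idem i) j
  add_zero := by
    rintro ⟨e⟩
    refine V.sound ?_
    refine ((IdemMat.directSum_mvn _ _).symm).trans (IdemMat.directSum _ _).idem e.idem ?_
    refine ⟨Matrix.of fun i j => Sum.elim (fun i => e.mat i j) (fun _ => 0) i,
      Matrix.of fun i j => Sum.elim (fun j => e.mat i j) (fun _ => 0) j, ?_, ?_⟩
    · ext (i | i) (j | j)
      · simpa [Matrix.mul_apply] using congrFun (congrFun e.idem i) j
      · exact j.elim0
      · exact i.elim0
      · exact i.elim0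
    · ext i j
      simpa [Matrix.mul_apply] using congrFun (congrFun e.idem i) j
  add_assoc := by
    rintro ⟨e⟩ ⟨f⟩ ⟨g⟩
    refine V.sound ?_
    have h1 : MvN (Matrix.fromBlocks (Matrix.fromBlocks e.mat 0 0 f.mat) 0 0 g.mat)
        ((e.directSum f).directSum g).mat :=
      ((e.directSum_mvn f).fromBlocks (MvN.refl g.idem)).trans
        (by simp [Matrix.fromBlocks_multiply, e.idem, f.idem, g.idem])
        ((e.directSum f).directSum g).idem ((e.directSum f).directSum_mvn g)
    have h2 : MvN (Matrix.fromBlocks e.mat 0 0 (Matrix.fromBlocks f.mat 0 0 g.mat))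
        (e.directSum (f.directSum g)).mat :=
      ((MvN.refl e.idem).fromBlocks (f.directSum_mvn g)).trans
        (by simp [Matrix.fromBlocks_multiply, e.idem, f.idem, g.idem])
        (e.directSum (f.directSum g)).idem (e.directSum_mvn (f.directSum g))
    have h3 : MvN (Matrix.fromBlocks (Matrix.fromBlocks e.mat 0 0 f.mat) 0 0 g.mat)
        (Matrix.fromBlocks e.mat 0 0 (Matrix.fromBlocks f.mat 0 0 g.mat)) := by
      have := MvN.reindex (e := Matrix.fromBlocks (Matrix.fromBlocks e.mat 0 0 f.mat) 0 0 g.mat)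
        (by simp [Matrix.fromBlocks_multiply, e.idem, f.idem, g.idem]) (Equiv.sumAssoc _ _ _)
      convert this using 1
      ext (i | i | i) (j | j | j) <;> simp [Matrix.fromBlocks]
    refine (h1.symm.trans ((e.directSum f).directSum g).idem ?_ h3).trans
      ((e.directSum f).directSum g).idem (e.directSum (f.directSum g)).idem h2
    simp [Matrix.fromBlocks_multiply, e.idem, f.idem, g.idem]
  add_comm := by
    rintro ⟨e⟩ ⟨f⟩
    refine V.sound ?_
    have h3 : MvN (Matrix.fromBlocks e.mat 0 0 f.mat) (Matrix.fromBlocks f.mat 0 0 e.mat) := by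
      have := MvN.reindex (e.blocks_idem f) (Equiv.sumComm _ _)
      convert this using 1
      ext (i | i) (j | j) <;> simp [Matrix.fromBlocks]
    exact (((e.directSum_mvn f).symm).trans (e.directSum f).idem (f.blocks_idem e) h3).trans
      (e.directSum f).idem (f.directSum e).idem (f.directSum_mvn e)
  nsmul := nsmulRec

/-- The algebraic `K`-theory group `K₀(A)`: the Grothendieck group of `V(A)`. -/
abbrev K0 (A : Type*) [Ring A] : Type _ := Algebra.GrothendieckAddGroup (V A)

/-- The class `[e] ∈ K₀(A)` of an idempotent matrix `e`. -/
def K0.cls {A : Type*} [Ring A] (e : IdemMat A) : K0 A :=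
  Algebra.GrothendieckAddGroup.of (V.mk e)

variable (A₁ A₂ : Type*) [Ring A₁] [Algebra ℂ A₁] [Ring A₂] [Algebra ℂ A₂]

theorem tensor_congr {e e' : IdemMat A₁} {f f' : IdemMat A₂} (h : MvN e.mat e'.mat)
    (h' : MvN f.mat f'.mat) : MvN (e.tensor f).mat (e'.tensor f').mat :=
  ((e.tensor_mvn f).symm.trans (e.tensor f).idem (e'.kron_idem f')
    (h.kronecker h')).trans (e.tensor f).idem (e'.tensor f').idem (e'.tensor_mvn f')

theorem MvN.of_eq {A : Type*} [Ring A] {m : Type*} [Fintype m]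
    {e f : Matrix m m A} (he : e * e = e) (h : e = f) : MvN e f := h ▸ MvN.refl he

/-- The bi-additive map `V(A₁) × V(A₂) → V(A₁ ⊗ A₂)`, `([e₁], [e₂]) ↦ [e₁ ⊗ e₂]`. -/
def V.tensor : V A₁ →+ V A₂ →+ V (A₁ ⊗[ℂ] A₂) where
  toFun x :=
    { toFun := fun y => Quotient.map₂ IdemMat.tensor
        (fun _ _ h _ _ h' => tensor_congr A₁ A₂ h h') x y
      map_zero' := by
        obtain ⟨e⟩ := x
        refine V.sound ?_
        refine ((IdemMat.tensor_mvn _ _).symm).trans (IdemMat.tensor _ _).idem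
          (IdemMat.zero _).idem ?_
        refine ⟨0, 0, ?_, ?_⟩
        · ext ⟨i, i'⟩
          exact i'.elim0
        · ext i
          exact i.elim0
      map_add' := by
        obtain ⟨e⟩ := x
        rintro ⟨f⟩ ⟨g⟩
        refine V.sound ?_
        have hb := e.kron_idem (f.directSum g)
        have hb' : (e.mat ⊗ₖₜ[ℂ] Matrix.fromBlocks f.mat 0 0 g.mat) *
            (e.mat ⊗ₖₜ[ℂ] Matrix.fromBlocks f.mat 0 0 g.mat) =
            e.mat ⊗ₖₜ[ℂ] Matrix.fromBlocks f.mat 0 0 g.mat := by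
          rw [← Matrix.mul_kroneckerTMul_mul, e.idem, f.blocks_idem g]
        have h1 : MvN (e.mat ⊗ₖₜ[ℂ] Matrix.fromBlocks f.mat 0 0 g.mat)
            (e.tensor (f.directSum g)).mat :=
          ((MvN.refl e.idem).kronecker (f.directSum_mvn g)).trans hb'
            (e.tensor (f.directSum g)).idem (e.tensor_mvn (f.directSum g))
        have hc : Matrix.fromBlocks (e.mat ⊗ₖₜ[ℂ] f.mat) 0 0 (e.mat ⊗ₖₜ[ℂ] g.mat) *
            Matrix.fromBlocks (e.mat ⊗ₖₜ[ℂ] f.mat) 0 0 (e.mat ⊗ₖₜ[ℂ] g.mat) =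
            Matrix.fromBlocks (e.mat ⊗ₖₜ[ℂ] f.mat) 0 0 (e.mat ⊗ₖₜ[ℂ] g.mat) := by
          simp [Matrix.fromBlocks_multiply, e.kron_idem]
        have h2 : MvN (Matrix.fromBlocks (e.mat ⊗ₖₜ[ℂ] f.mat) 0 0 (e.mat ⊗ₖₜ[ℂ] g.mat))
            ((e.tensor f).directSum (e.tensor g)).mat :=
          ((e.tensor_mvn f).fromBlocks (e.tensor_mvn g)).trans hc
            ((e.tensor f).directSum (e.tensor g)).idem ((e.tensor f).directSum_mvn (e.tensor g))
        have h3 : MvN (e.mat ⊗ₖₜ[ℂ] Matrix.fromBlocks f.mat 0 0 g.mat)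
            (Matrix.fromBlocks (e.mat ⊗ₖₜ[ℂ] f.mat) 0 0 (e.mat ⊗ₖₜ[ℂ] g.mat)) := by
          refine (MvN.reindex hb' (Equiv.prodSumDistrib _ _ _)).trans hb' hc
            (MvN.of_eq ?_ ?_)
          · simp only [Matrix.reindex_apply]
            rw [Matrix.submatrix_mul_equiv, hb']
          · ext (⟨i, i'⟩ | ⟨i, i'⟩) (⟨j, j'⟩ | ⟨j, j'⟩) <;> simp [Matrix.fromBlocks]
        exact (h1.symm.trans (e.tensor (f.directSum g)).idem hc h3).trans
          (e.tensor (f.directSum g)).idem ((e.tensor f).directSum (e.tensor g)).idem h2 }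
  map_zero' := by
    ext ⟨f⟩
    refine V.sound ?_
    refine ((IdemMat.tensor_mvn _ _).symm).trans (IdemMat.tensor _ _).idem
      (IdemMat.zero _).idem ?_
    refine ⟨0, 0, ?_, ?_⟩
    · ext ⟨i, i'⟩
      exact i.elim0
    · ext i
      exact i.elim0
  map_add' := by
    rintro ⟨f⟩ ⟨g⟩
    ext ⟨e⟩
    refine V.sound ?_
    have hb := (f.directSum g).kron_idem e
    have hb' : (Matrix.fromBlocks f.mat 0 0 g.mat ⊗ₖₜ[ℂ] e.mat) *
        (Matrix.fromBlocks f.mat 0 0 g.mat ⊗ₖₜ[ℂ] e.mat) =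
        Matrix.fromBlocks f.mat 0 0 g.mat ⊗ₖₜ[ℂ] e.mat := by
      rw [← Matrix.mul_kroneckerTMul_mul, e.idem, f.blocks_idem g]
    have h1 : MvN (Matrix.fromBlocks f.mat 0 0 g.mat ⊗ₖₜ[ℂ] e.mat)
        ((f.directSum g).tensor e).mat :=
      ((f.directSum_mvn g).kronecker (MvN.refl e.idem)).trans hb'
        ((f.directSum g).tensor e).idem ((f.directSum g).tensor_mvn e)
    have hc : Matrix.fromBlocks (f.mat ⊗ₖₜ[ℂ] e.mat) 0 0 (g.mat ⊗ₖₜ[ℂ] e.mat) *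
        Matrix.fromBlocks (f.mat ⊗ₖₜ[ℂ] e.mat) 0 0 (g.mat ⊗ₖₜ[ℂ] e.mat) =
        Matrix.fromBlocks (f.mat ⊗ₖₜ[ℂ] e.mat) 0 0 (g.mat ⊗ₖₜ[ℂ] e.mat) := by
      simp [Matrix.fromBlocks_multiply, IdemMat.kron_idem]
    have h2 : MvN (Matrix.fromBlocks (f.mat ⊗ₖₜ[ℂ] e.mat) 0 0 (g.mat ⊗ₖₜ[ℂ] e.mat))
        ((f.tensor e).directSum (g.tensor e)).mat :=
      ((f.tensor_mvn e).fromBlocks (g.tensor_mvn e)).trans hc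
        ((f.tensor e).directSum (g.tensor e)).idem ((f.tensor e).directSum_mvn (g.tensor e))
    have h3 : MvN (Matrix.fromBlocks f.mat 0 0 g.mat ⊗ₖₜ[ℂ] e.mat)
        (Matrix.fromBlocks (f.mat ⊗ₖₜ[ℂ] e.mat) 0 0 (g.mat ⊗ₖₜ[ℂ] e.mat)) := by
      refine (MvN.reindex hb' (Equiv.sumProdDistrib _ _ _)).trans hb' hc
        (MvN.of_eq ?_ ?_)
      · simp only [Matrix.reindex_apply]
        rw [Matrix.submatrix_mul_equiv, hb']
      · ext (⟨i, i'⟩ | ⟨i, i'⟩) (⟨j, j'⟩ | ⟨j, j'⟩) <;> simp [Matrix.fromBlocks]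
    exact (h1.symm.trans ((f.directSum g).tensor e).idem hc h3).trans
      ((f.directSum g).tensor e).idem ((f.tensor e).directSum (g.tensor e)).idem h2

/-- The natural bi-additive map `K₀(A₁) × K₀(A₂) → K₀(A₁ ⊗ A₂)`, `([e₁], [e₂]) ↦ [e₁ ⊗ e₂]`. -/
def K0.tensor : K0 A₁ →+ K0 A₂ →+ K0 (A₁ ⊗[ℂ] A₂) :=
  Algebra.GrothendieckAddGroup.lift
    { toFun := fun x => Algebra.GrothendieckAddGroup.lift
        ((Algebra.GrothendieckAddGroup.of (M := V (A₁ ⊗[ℂ] A₂))).comp (V.tensor A₁ A₂ x))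
      map_zero' := by
        rw [map_zero, AddMonoidHom.comp_zero]
        refine Algebra.GrothendieckAddGroup.lift.symm.injective ?_
        rw [Equiv.symm_apply_apply, Algebra.GrothendieckAddGroup.lift_symm_apply]
        rfl
      map_add' := fun x y => by
        rw [map_add, AddMonoidHom.comp_add]
        refine Algebra.GrothendieckAddGroup.lift.symm.injective ?_
        rw [Equiv.symm_apply_apply, Algebra.GrothendieckAddGroup.lift_symm_apply,
          AddMonoidHom.add_comp, ← Algebra.GrothendieckAddGroup.lift_symm_apply,
          ← Algebra.GrothendieckAddGroup.lift_symm_apply, Equiv.symm_apply_apply,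
          Equiv.symm_apply_apply] }

theorem K0.tensor_cls (e : IdemMat A₁) (f : IdemMat A₂) :
    K0.tensor A₁ A₂ (K0.cls e) (K0.cls f) = K0.cls (e.tensor f) := by
  simp only [K0.tensor, K0.cls]
  have h1 := fun (g : V A₁ →+ (K0 A₂ →+ K0 (A₁ ⊗[ℂ] A₂))) (x : V A₁) =>
    DFunLike.congr_fun (Algebra.GrothendieckAddGroup.lift.symm_apply_apply g) x
  have h2 := fun (g : V A₂ →+ K0 (A₁ ⊗[ℂ] A₂)) (x : V A₂) =>
    DFunLike.congr_fun (Algebra.GrothendieckAddGroup.lift.symm_apply_apply g) x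
  simp only [Algebra.GrothendieckAddGroup.lift_symm_apply, AddMonoidHom.comp_apply] at h1 h2
  rw [h1]
  exact h2 _ _

end KTheory

/-! ### Twisted spectral triples

A `ℤ₂`-graded Hilbert space is a Hilbert space `H` with a closed subspace `Hp` (the even part `H⁺`);
the odd part `H⁻` is the orthogonal complement `Hpᗮ`. -/

section SpectralTriples

variable {H : Type*} [NormedAddCommGroup H] [InnerProductSpace ℂ H]

/-- A bounded operator is even when it preserves both `H⁺` and `H⁻`. -/
def IsEven (Hp : Submodule ℂ H) (T : H →L[ℂ] H) : Prop :=
  (∀ x ∈ Hp, T x ∈ Hp) ∧ (∀ x ∈ Hpᗮ, T x ∈ Hpᗮ)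

/-- An unbounded operator `D` is odd when its domain splits as
`(dom D ∩ H⁺) ⊕ (dom D ∩ H⁻)` and `D` maps `dom D ∩ H⁺` to `H⁻` and `dom D ∩ H⁻` to `H⁺`. -/
structure IsOdd (Hp : Submodule ℂ H) (D : H →ₗ.[ℂ] H) : Prop where
  domain_splits : D.domain ≤ (D.domain ⊓ Hp) ⊔ (D.domain ⊓ Hpᗮ)
  map_plus : ∀ x : D.domain, (x : H) ∈ Hp → D x ∈ Hpᗮ
  map_minus : ∀ x : D.domain, (x : H) ∈ Hpᗮ → D x ∈ Hp

/-- The resolvent `(D + i)⁻¹` exists as an everywhere defined operator and is compact. -/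
def HasCompactResolvent (D : H →ₗ.[ℂ] H) : Prop :=
  ∃ R : H →L[ℂ] H, IsCompactOperator R ∧
    (∀ y : H, ∃ h : R y ∈ D.domain, D ⟨R y, h⟩ + Complex.I • R y = y) ∧
    (∀ x : D.domain, R (D x + Complex.I • (x : H)) = x)

/-- `(A, H, D)_σ` is a twisted spectral triple, where the involutive unital algebra `A` acts on
`H` through `π` and `H` is graded by `H = Hp ⊕ Hpᗮ`. -/
structure IsTwistedSpectralTriple [CompleteSpace H] {A : Type*} [Ring A] [Algebra ℂ A] [StarRing A]
    [StarModule ℂ A] (Hp : Submodule ℂ H) (π : A →⋆ₐ[ℂ] (H →L[ℂ] H)) (D : H →ₗ.[ℂ] H)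
    (σ : A ≃ₐ[ℂ] A) : Prop where
  isClosed_plus : IsClosed (Hp : Set H)
  even : ∀ a, IsEven Hp (π a)
  star_twist : ∀ a, star (σ a) = σ.symm (star a)
  odd : IsOdd Hp D
  selfAdjoint : IsSelfAdjoint D
  compactResolvent : HasCompactResolvent D
  preserves_domain : ∀ a, ∀ x ∈ D.domain, π a x ∈ D.domain
  /-- `[D, a]_σ = D a - σ(a) D` is bounded. -/
  bounded_twisted_commutator : ∀ a, ∃ C : ℝ, ∀ (x : D.domain) (h : π a x ∈ D.domain),
    ‖D ⟨π a x, h⟩ - π (σ a) (D x)‖ ≤ C * ‖(x : H)‖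

/-- `(A, H, D)` is an (ordinary) spectral triple: a twisted one with `σ = id`, so that
`[D, a]_σ = [D, a]`. -/
def IsSpectralTriple [CompleteSpace H] {A : Type*} [Ring A] [Algebra ℂ A] [StarRing A]
    [StarModule ℂ A] (Hp : Submodule ℂ H) (π : A →⋆ₐ[ℂ] (H →L[ℂ] H)) (D : H →ₗ.[ℂ] H) : Prop :=
  IsTwistedSpectralTriple Hp π D AlgEquiv.refl

/-! ### The index map -/

section Index

variable {B : Type*} [Ring B] [Algebra ℂ B] {ι : Type*} [Fintype ι]

/-- The action of a matrix `M ∈ M_q(B)` on `H^q`. -/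
def matAct (π : B →ₐ[ℂ] (H →L[ℂ] H)) (M : Matrix ι ι B) : (ι → H) →ₗ[ℂ] (ι → H) :=
  LinearMap.pi fun i => ∑ j, (π (M i j)).toLinearMap ∘ₗ LinearMap.proj j

/-- For `S = H^±`: the domain of `D_{e,σ}^±`, that is
`e (dom D ∩ S)^q = (dom D ∩ S)^q ∩ e H^q`. -/
def twDom (π : B →ₐ[ℂ] (H →L[ℂ] H)) (D : H →ₗ.[ℂ] H) (S : Submodule ℂ H) (e : Matrix ι ι B) :
    Submodule ℂ (ι → H) :=
  Submodule.pi Set.univ (fun _ => D.domain ⊓ S) ⊓ LinearMap.range (matAct π e)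

theorem twDom_mem {π : B →ₐ[ℂ] (H →L[ℂ] H)} {D : H →ₗ.[ℂ] H} {S : Submodule ℂ H}
    {e : Matrix ι ι B} (ξ : twDom π D S e) (i : ι) : (ξ : ι → H) i ∈ D.domain :=
  (Submodule.mem_inf.1 (Submodule.mem_pi.1 (Submodule.mem_inf.1 ξ.2).1 i (Set.mem_univ i))).1

/-- The operator `D_{e,σ}^± = σ(e) (D ⊗ 1_q)` on `e (dom D ∩ S)^q`, where `S = H^±`. -/
def twDirac (π : B →ₐ[ℂ] (H →L[ℂ] H)) (D : H →ₗ.[ℂ] H) (σ : B ≃ₐ[ℂ] B) (S : Submodule ℂ H)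
    (e : Matrix ι ι B) : twDom π D S e →ₗ[ℂ] (ι → H) :=
  matAct π (e.map σ) ∘ₗ LinearMap.pi fun i =>
    D.toFun ∘ₗ LinearMap.codRestrict D.domain
      (LinearMap.proj i ∘ₗ (twDom π D S e).subtype) (fun ξ => twDom_mem ξ i)

/-- The target space `σ(e) (S')^q` of `D_{e,σ}^±`, where `S' = H^∓`. -/
def twTarget (π : B →ₐ[ℂ] (H →L[ℂ] H)) (σ : B ≃ₐ[ℂ] B) (S' : Submodule ℂ H) (e : Matrix ι ι B) :
    Submodule ℂ (ι → H) :=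
  (Submodule.pi Set.univ (fun _ => S')).map (matAct π (e.map σ))

/-- The Fredholm index `dim ker - dim coker` of `D_{e,σ}^± : e (dom D ∩ S)^q → σ(e) (S')^q`,
where `S = H^±`, `S' = H^∓`. -/
def chiralIndex (π : B →ₐ[ℂ] (H →L[ℂ] H)) (D : H →ₗ.[ℂ] H) (σ : B ≃ₐ[ℂ] B)
    (S S' : Submodule ℂ H) (e : Matrix ι ι B) : ℤ :=
  (Module.finrank ℂ (LinearMap.ker (twDirac π D σ S e)) : ℤ) -
    Module.finrank ℂ (twTarget π σ S' e ⧸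
      (LinearMap.range (twDirac π D σ S e)).submoduleOf (twTarget π σ S' e))

/-- The index `ind D_{e,σ} = (ind D_{e,σ}⁺ - ind D_{e,σ}⁻) / 2`. -/
def diracIndex (Hp : Submodule ℂ H) (π : B →ₐ[ℂ] (H →L[ℂ] H)) (D : H →ₗ.[ℂ] H) (σ : B ≃ₐ[ℂ] B)
    (e : Matrix ι ι B) : ℚ :=
  ((chiralIndex π D σ Hp Hpᗮ e : ℚ) - chiralIndex π D σ Hpᗮ Hp e) / 2

open Classical in
/-- The index map `ind_{D,σ} : K₀(B) → ½ℤ ⊆ ℚ`: the unique additive map with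
`ind_{D,σ}[e] = ind D_{e,σ}` for all idempotents `e` over `B` (the value `0` is only used when
no such map exists, which never happens for a twisted spectral triple). -/
def indexMap (Hp : Submodule ℂ H) (π : B →ₐ[ℂ] (H →L[ℂ] H)) (D : H →ₗ.[ℂ] H) (σ : B ≃ₐ[ℂ] B) :
    K0 B →+ ℚ :=
  if h : ∃ f : K0 B →+ ℚ, ∀ e : IdemMat B, f (K0.cls e) = diracIndex Hp π D σ e.mat
  then h.choose else 0

/-- An additive map on `K₀(B)` is determined by its values on classes of idempotents. -/
theorem K0.hom_ext {G : Type*} [AddCommGroup G] {f g : K0 B →+ G}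
    (h : ∀ e : IdemMat B, f (K0.cls e) = g (K0.cls e)) : f = g := by
  refine Algebra.GrothendieckAddGroup.lift.symm.injective ?_
  ext ⟨e⟩
  exact h e

theorem indexMap_eq {Hp : Submodule ℂ H} {π : B →ₐ[ℂ] (H →L[ℂ] H)} {D : H →ₗ.[ℂ] H}
    {σ : B ≃ₐ[ℂ] B} {f : K0 B →+ ℚ}
    (hf : ∀ e : IdemMat B, f (K0.cls e) = diracIndex Hp π D σ e.mat) :
    indexMap Hp π D σ = f := by
  have h : ∃ f : K0 B →+ ℚ, ∀ e : IdemMat B, f (K0.cls e) = diracIndex Hp π D σ e.mat := ⟨f, hf⟩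
  rw [indexMap, dif_pos h]
  exact K0.hom_ext fun e => (h.choose_spec e).trans (hf e).symm

end Index

/-! ### Poincaré duality -/

section Duality

variable [CompleteSpace H] {A₁ A₂ : Type*} [Ring A₁] [Algebra ℂ A₁] [StarRing A₁] [StarModule ℂ A₁]
  [Ring A₂] [Algebra ℂ A₂] [StarRing A₂] [StarModule ℂ A₂]

/-- The representation `a₁ ⊗ a₂ ↦ a₁ a₂` of `A₁ ⊗ A₂` defined by commuting representations. -/
def tensorRep (π₁ : A₁ →⋆ₐ[ℂ] (H →L[ℂ] H)) (π₂ : A₂ →⋆ₐ[ℂ] (H →L[ℂ] H))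
    (hc : ∀ a₁ a₂, Commute (π₁ a₁) (π₂ a₂)) : A₁ ⊗[ℂ] A₂ →ₐ[ℂ] (H →L[ℂ] H) :=
  Algebra.TensorProduct.lift π₁.toAlgHom π₂.toAlgHom hc

/-- The rational extension `(ℚ ⊗ K₀(A₁)) × (ℚ ⊗ K₀(A₂)) → ℚ` of a bi-additive map. -/
def ratExtend {M N : Type*} [AddCommGroup M] [AddCommGroup N] (f : M →+ N →+ ℚ) :
    (ℚ ⊗[ℤ] M) →ₗ[ℚ] (ℚ ⊗[ℤ] N) →ₗ[ℚ] ℚ :=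
  LinearMap.liftBaseChange ℚ (AddMonoidHom.toIntLinearMap
    (AddMonoidHom.mk' (fun x => LinearMap.liftBaseChange ℚ (f x).toIntLinearMap)
      (fun x y => by ext; simp)))

/-- The pairing `(K₀(A₁) ⊗ ℚ) × (K₀(A₂) ⊗ ℚ) → ℚ` obtained by composing the index map
`ind_{D,σ₁⊗σ₂} : K₀(A₁ ⊗ A₂) → ½ℤ` with `K₀(A₁) × K₀(A₂) → K₀(A₁ ⊗ A₂)`. -/
def dualityPairing (Hp : Submodule ℂ H) (π₁ : A₁ →⋆ₐ[ℂ] (H →L[ℂ] H))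
    (π₂ : A₂ →⋆ₐ[ℂ] (H →L[ℂ] H)) (hc : ∀ a₁ a₂, Commute (π₁ a₁) (π₂ a₂)) (D : H →ₗ.[ℂ] H)
    (σ₁ : A₁ ≃ₐ[ℂ] A₁) (σ₂ : A₂ ≃ₐ[ℂ] A₂) :
    (ℚ ⊗[ℤ] K0 A₁) →ₗ[ℚ] (ℚ ⊗[ℤ] K0 A₂) →ₗ[ℚ] ℚ :=
  ratExtend ((AddMonoidHom.compHom (indexMap Hp (tensorRep π₁ π₂ hc) D
    (Algebra.TensorProduct.congr σ₁ σ₂))).comp (K0.tensor A₁ A₂))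

theorem dualityPairing_tmul (Hp : Submodule ℂ H) (π₁ : A₁ →⋆ₐ[ℂ] (H →L[ℂ] H))
    (π₂ : A₂ →⋆ₐ[ℂ] (H →L[ℂ] H)) (hc : ∀ a₁ a₂, Commute (π₁ a₁) (π₂ a₂)) (D : H →ₗ.[ℂ] H)
    (σ₁ : A₁ ≃ₐ[ℂ] A₁) (σ₂ : A₂ ≃ₐ[ℂ] A₂) (r s : ℚ) (e₁ : IdemMat A₁) (e₂ : IdemMat A₂) :
    dualityPairing Hp π₁ π₂ hc D σ₁ σ₂ (r ⊗ₜ K0.cls e₁) (s ⊗ₜ K0.cls e₂) =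
      r * s * indexMap Hp (tensorRep π₁ π₂ hc) D (Algebra.TensorProduct.congr σ₁ σ₂)
        (K0.cls (e₁.tensor e₂)) := by
  simp only [dualityPairing, ratExtend, LinearMap.liftBaseChange_tmul, LinearMap.smul_apply,
    AddMonoidHom.coe_toIntLinearMap, AddMonoidHom.mk'_apply, AddMonoidHom.comp_apply,
    AddMonoidHom.compHom_apply_apply, K0.tensor_cls, smul_eq_mul]
  ring

/-- The twisted spectral triples `(A₁, H, D)_{σ₁}` and `(A₂, H, D)_{σ₂}` are in Poincaré
duality. -/
structure InPoincareDuality (Hp : Submodule ℂ H) (π₁ : A₁ →⋆ₐ[ℂ] (H →L[ℂ] H))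
    (π₂ : A₂ →⋆ₐ[ℂ] (H →L[ℂ] H)) (D : H →ₗ.[ℂ] H) (σ₁ : A₁ ≃ₐ[ℂ] A₁) (σ₂ : A₂ ≃ₐ[ℂ] A₂) :
    Prop where
  triple₁ : IsTwistedSpectralTriple Hp π₁ D σ₁
  triple₂ : IsTwistedSpectralTriple Hp π₂ D σ₂
  commute : ∀ a₁ a₂, Commute (π₁ a₁) (π₂ a₂)
  /-- `[[D, a₁]_{σ₁}, a₂]_{σ₂} = 0` on `dom D`. -/
  order_one : ∀ (a₁ : A₁) (a₂ : A₂) (x : D.domain) (h₁ : π₁ a₁ x ∈ D.domain)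
    (h₂ : π₂ a₂ x ∈ D.domain) (h₁₂ : π₁ a₁ (π₂ a₂ x) ∈ D.domain),
    (D ⟨π₁ a₁ (π₂ a₂ x), h₁₂⟩ - π₁ (σ₁ a₁) (D ⟨π₂ a₂ x, h₂⟩)) -
      π₂ (σ₂ a₂) (D ⟨π₁ a₁ x, h₁⟩ - π₁ (σ₁ a₁) (D x)) = 0
  nondegenerate : (dualityPairing Hp π₁ π₂ commute D σ₁ σ₂).Nondegenerate

/-- The ordinary spectral triples `(A₁, H, D)` and `(A₂, H, D)` are in Poincaré duality: the case
`σ₁ = id`, `σ₂ = id`, where all the twisted commutators are commutators and the pairing is defined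
by the index map of the ordinary spectral triple `(A₁ ⊗ A₂, H, D)`. -/
def InOrdinaryPoincareDuality (Hp : Submodule ℂ H) (π₁ : A₁ →⋆ₐ[ℂ] (H →L[ℂ] H))
    (π₂ : A₂ →⋆ₐ[ℂ] (H →L[ℂ] H)) (D : H →ₗ.[ℂ] H) : Prop :=
  InPoincareDuality Hp π₁ π₂ D AlgEquiv.refl AlgEquiv.refl

end Duality

/-! ### Pseudo-inner twistings -/

section PseudoInner

/-- The inner automorphism `a ↦ k a k⁻¹`. -/
def innerAut {A : Type*} [Ring A] [Algebra ℂ A] (k : Aˣ) : A ≃ₐ[ℂ] A where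
  toFun a := k * a * (k⁻¹ : Aˣ)
  invFun a := (k⁻¹ : Aˣ) * a * k
  left_inv a := by simp [mul_assoc]
  right_inv a := by simp [mul_assoc]
  map_mul' a b := by simp [mul_assoc]
  map_add' a b := by simp [mul_add, add_mul]
  commutes' r := by
    rw [← Algebra.commutes, mul_assoc, Units.mul_inv, mul_one]

/-- The operator `D_ω = ω D ω` with domain `dom D`, for `ω` preserving `dom D`. -/
def conjDirac (D : H →ₗ.[ℂ] H) (ω : H →L[ℂ] H) (hω : ∀ x, ω x ∈ D.domain ↔ x ∈ D.domain) :
    H →ₗ.[ℂ] H where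
  domain := D.domain
  toFun := ω.toLinearMap ∘ₗ D.toFun ∘ₗ LinearMap.codRestrict D.domain
    (ω.toLinearMap ∘ₗ D.domain.subtype) (fun x => (hω x).2 x.2)

theorem conjDirac_apply (D : H →ₗ.[ℂ] H) (ω : H →L[ℂ] H)
    (hω : ∀ x, ω x ∈ D.domain ↔ x ∈ D.domain) (x : D.domain) :
    conjDirac D ω hω x = ω (D ⟨ω x, (hω x).2 x.2⟩) := rfl

/-- A positive element of the involutive algebra `A` acting on `H` through `π`: a selfadjoint
element that acts as a positive operator. -/
def IsPos [CompleteSpace H] {A : Type*} [Ring A] [Algebra ℂ A] [StarRing A]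
    [StarModule ℂ A] (π : A →⋆ₐ[ℂ] (H →L[ℂ] H)) (k : A) : Prop :=
  IsSelfAdjoint k ∧ (π k).IsPositive

/-- The even positive invertible operator `ω = ω⁺ ⊕ ω⁻` is a pseudo-inner twisting operator of
the spectral triple `(A, H, D)`, with associated positive invertible elements `kp = k⁺`,
`km = k⁻` of `A`. -/
structure IsPseudoInnerTwisting [CompleteSpace H] {A : Type*} [Ring A] [Algebra ℂ A] [StarRing A]
    [StarModule ℂ A] (Hp : Submodule ℂ H) (π : A →⋆ₐ[ℂ] (H →L[ℂ] H)) (D : H →ₗ.[ℂ] H)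
    (ω : (H →L[ℂ] H)ˣ) (kp km : Aˣ) : Prop where
  even : IsEven Hp (ω : H →L[ℂ] H)
  positive : (ω : H →L[ℂ] H).IsPositive
  /-- `ω (dom D) = dom D` -/
  preserves_domain : ∀ x, (ω : H →L[ℂ] H) x ∈ D.domain ↔ x ∈ D.domain
  pos_kp : IsPos π (kp : A)
  pos_km : IsPos π (km : A)
  commute : kp * km = km * kp
  /-- `ω⁺ a (ω⁺)⁻¹ = k⁺ a (k⁺)⁻¹` on `H⁺` -/
  twist_plus : ∀ a, ∀ x ∈ Hp,
    ((ω : H →L[ℂ] H) * π a * ((ω⁻¹ : (H →L[ℂ] H)ˣ) : H →L[ℂ] H)) x =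
      π (kp * a * (kp⁻¹ : Aˣ)) x
  /-- `ω⁻ a (ω⁻)⁻¹ = k⁻ a (k⁻)⁻¹` on `H⁻` -/
  twist_minus : ∀ a, ∀ x ∈ Hpᗮ,
    ((ω : H →L[ℂ] H) * π a * ((ω⁻¹ : (H →L[ℂ] H)ˣ) : H →L[ℂ] H)) x =
      π (km * a * (km⁻¹ : Aˣ)) x

end PseudoInner

end SpectralTriples

end TwistedPD

namespace TwistedPD

/-! ### Indices of linear maps -/

section AlgebraicIndex

variable {k X Y X' Y' : Type*} [Field k] [AddCommGroup X] [Module k X] [AddCommGroup Y] [Module k Y]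
  [AddCommGroup X'] [Module k X'] [AddCommGroup Y'] [Module k Y']

/-! The pairing sees `D` only through the index map of `A₁ ⊗ A₂`, so nondegeneracy transfers once
the twisted index of `ωDω` equals the ordinary index of `D` on every idempotent
(`indexMap_conjDirac`). The two operators `ω` that act on `A₁` and `A₂` are one and the same, so `ω`
twists `A₁ ⊗ A₂` by `k₁^± ⊗ k₂^±` (`tensorRep_twist`).

For the index, write `g = k⁺`, `g' = k⁻` on `S = H⁺`, and exchange the roles on `H⁻`. On `S` the
operator `α = g⁻¹ω` commutes with the algebra; on `Sᗮ` the operator `β = g⁻¹ω⁻¹` satisfies `β σ(b) =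
b β`. Hence `α` preserves `e(dom D ∩ S)^q`, `β` carries `σ(e)(Sᗮ)^q` onto `e(Sᗮ)^q`, and `β
σ(e)(ωDω) α⁻¹ = e g⁻¹Dg = e(D + g⁻¹[D,g])`. So, up to isomorphisms, the twisted operator is a
compression of a bounded perturbation of `D` (`chiralIndex_conjDirac`). Such a perturbation does not
affect the index: for `R = (D+i)⁻¹` and `P` the projection onto `S`, the operator `Q = ePR` is a
right parametrix for every perturbation at once, the composite being `1 + compact` and so of index
zero, which makes every index equal to `-ind Q` (`index_compression_eq`, `index_one_add_compact`).

The remaining axioms follow from the shape of `ω`. On `dom D ∩ H⁺` the twisted commutator with `a`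
is `ω[D, k⁺a(k⁺)⁻¹]ω`, because the first `ω` acts on `H⁺` and the second on `H⁻`, which produces
`k⁻k⁺`; on `H⁻` the product is `k⁺k⁻`, the same since the two commute. Boundedness and the vanishing
of double commutators are read off from this. Compactness of the resolvent comes from `ωDω + i = ω(D
+ iω⁻²)ω` and the Fredholm alternative. -/

theorem index_eq_of_intertwine {T : X →ₗ[k] Y} {T' : X' →ₗ[k] Y'} (α : X ≃ₗ[k] X')
    (β : Y ≃ₗ[k] Y') (h : ∀ x, β (T x) = T' (α x)) : T.index = T'.index := by
  have hk : T.ker.map (α : X →ₗ[k] X') = T'.ker := by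
    ext x
    obtain ⟨x, rfl⟩ := α.surjective x
    simp [← h]
  have hr : T.range.map (β : Y →ₗ[k] Y') = T'.range := by
    ext y
    simp only [Submodule.mem_map, LinearMap.mem_range, LinearEquiv.coe_coe]
    constructor
    · rintro ⟨_, ⟨x, rfl⟩, rfl⟩
      exact ⟨α x, (h x).symm⟩
    · rintro ⟨x, rfl⟩
      exact ⟨_, ⟨α.symm x, rfl⟩, by simp [h]⟩
  rw [LinearMap.index_eq_finrank_sub, LinearMap.index_eq_finrank_sub,
    (α.submoduleMap T.ker).finrank_eq, hk, (Submodule.Quotient.equiv _ _ β hr).finrank_eq]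

/-- A linear map that agrees with an isomorphism on a subspace of finite codimension has finite
dimensional kernel and cokernel, and index zero. -/
theorem index_eq_zero_of_eqOn {T : X →ₗ[k] Y} (U : X ≃ₗ[k] Y) (N : Submodule k X)
    [FiniteDimensional k (X ⧸ N)] (h : ∀ x ∈ N, T x = U x) :
    T.index = 0 ∧ FiniteDimensional k T.ker ∧ FiniteDimensional k (Y ⧸ T.range) := by
  -- `T` is injective on `N`, so its kernel embeds in `X ⧸ N`.
  have hk : FiniteDimensional k T.ker := by
    refine Module.Finite.of_injective (N.mkQ ∘ₗ T.ker.subtype) ?_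
    rw [← LinearMap.ker_eq_bot, LinearMap.ker_eq_bot']
    rintro ⟨x, hx⟩ hxN
    have hxN : x ∈ N := by simpa using hxN
    have h0 : U x = 0 := by rw [← h x hxN]; exact hx
    simpa using h0
  have hc : FiniteDimensional k (Y ⧸ T.range) := by
    have hle : N ≤ Submodule.comap (U : X →ₗ[k] Y) T.range := fun x hx =>
      Submodule.mem_comap.2 ⟨x, h x hx⟩
    refine Module.Finite.of_surjective (N.mapQ T.range (U : X →ₗ[k] Y) hle) fun y => ?_
    obtain ⟨y, rfl⟩ := Submodule.Quotient.mk_surjective _ y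
    exact ⟨Submodule.Quotient.mk (U.symm y), by simp⟩
  refine ⟨?_, hk, hc⟩
  -- Both `T` and `U` have the same composite with the inclusion of `N`, which has finite
  -- dimensional kernel and cokernel; additivity of the index cancels the inclusion.
  have hi : FiniteDimensional k N.subtype.ker := by rw [Submodule.ker_subtype]; infer_instance
  have hi' : FiniteDimensional k (X ⧸ N.subtype.range) := by
    rw [Submodule.range_subtype]; infer_instance
  have hU : FiniteDimensional k (U : X →ₗ[k] Y).ker := by
    rw [LinearEquiv.ker]; infer_instance
  have hU' : FiniteDimensional k (Y ⧸ (U : X →ₗ[k] Y).range) := by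
    rw [LinearEquiv.range]; infer_instance
  have e : T ∘ₗ N.subtype = (U : X →ₗ[k] Y) ∘ₗ N.subtype := by
    ext x
    exact h x x.2
  have h1 := LinearMap.index_comp (f := N.subtype) T
  have h2 := LinearMap.index_comp (f := N.subtype) (U : X →ₗ[k] Y)
  rw [e, h2, LinearEquiv.index_eq_zero] at h1
  linarith

/-- If `T ∘ Q` is Fredholm of index zero and `T` has finite dimensional kernel, then the index of
`T` is opposite to the index of `Q`. -/
theorem index_eq_neg_of_comp {T : X →ₗ[k] Y} {Q : Y →ₗ[k] X} (h0 : (T ∘ₗ Q).index = 0)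
    (hk : FiniteDimensional k (T ∘ₗ Q).ker) (hc : FiniteDimensional k (Y ⧸ (T ∘ₗ Q).range))
    (hT : FiniteDimensional k T.ker) : T.index = -Q.index := by
  have h1 : FiniteDimensional k Q.ker :=
    Submodule.finiteDimensional_of_le (LinearMap.ker_le_ker_comp Q T)
  have h2 : FiniteDimensional k (Y ⧸ T.range) :=
    Module.Finite.of_surjective _ (Submodule.factor_surjective (LinearMap.range_comp_le_range Q T))
  -- Exactness of `ker T → X/ran Q → Y/ran(TQ)` at the middle term bounds the cokernel of `Q` by two
  -- finite dimensional spaces.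
  have h3 : FiniteDimensional k (X ⧸ Q.range) := by
    have hle : Q.range ≤ Submodule.comap T (T ∘ₗ Q).range := by
      rintro _ ⟨y, rfl⟩
      exact ⟨y, rfl⟩
    let f : T.ker →ₗ[k] X ⧸ Q.range := Q.range.mkQ ∘ₗ T.ker.subtype
    let g : (X ⧸ Q.range) →ₗ[k] Y ⧸ (T ∘ₗ Q).range := Q.range.mapQ _ T hle
    have hgf : g.ker ≤ f.range := by
      intro x hx
      obtain ⟨x, rfl⟩ := Submodule.Quotient.mk_surjective _ x
      have hx' : T x ∈ (T ∘ₗ Q).range := by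
        simpa [g, Submodule.mapQ_apply] using hx
      obtain ⟨y, hy⟩ := hx'
      refine ⟨⟨x - Q y, by simpa [sub_eq_zero] using hy.symm⟩, ?_⟩
      have : (Submodule.Quotient.mk (Q y) : X ⧸ Q.range) = 0 := by simp
      simp [f, this]
    have : FiniteDimensional k g.ker := Submodule.finiteDimensional_of_le hgf
    have : FiniteDimensional k ((X ⧸ Q.range) ⧸ g.ker) :=
      Module.Finite.equiv g.quotKerEquivRange.symm
    exact Module.Finite.of_submodule_quotient g.ker
  have := LinearMap.index_comp (f := Q) T
  linarith

end AlgebraicIndex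

/-! ### Compact operators and finite rank operators -/

section FiniteRank

variable {E : Type*} [NormedAddCommGroup E] [NormedSpace ℂ E]

/-- The fixed space of `K` is closed and invariant, and the identity on it is a restriction of `K`,
hence compact; Riesz's theorem applies. This is how kernels are shown to be finite dimensional. -/
theorem finiteDimensional_of_compact_fixed {K : E →L[ℂ] E} (hK : IsCompactOperator K)
    (N : Submodule ℂ E) (hN : ∀ x ∈ N, K x = x) : FiniteDimensional ℂ N := by
  let W : Submodule ℂ E := LinearMap.eqLocus (K : E →ₗ[ℂ] E) LinearMap.id
  have hW : IsClosed (W : Set E) := isClosed_eq K.continuous continuous_id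
  have hWK : ∀ x ∈ W, (K : E →ₗ[ℂ] E) x ∈ W := fun x hx => by
    have hx' : K x = x := hx
    simpa [hx'] using hx
  have h := IsCompactOperator.restrict (f := (K : E →ₗ[ℂ] E)) hK hWK hW
  have hid : ⇑((K : E →ₗ[ℂ] E).restrict hWK) = id := by
    ext x
    exact x.2
  rw [hid] at h
  have := FiniteDimensional.of_isCompactOperator_id (𝕜 := ℂ) h
  exact Submodule.finiteDimensional_of_le (S₂ := W) fun x hx => hN x hx

/-- The compact operators on `E` can be approximated in norm by operators of finite rank. -/
def CompactApprox (E : Type*) [NormedAddCommGroup E] [NormedSpace ℂ E] : Prop :=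
  ∀ K : E →L[ℂ] E, IsCompactOperator K → ∀ ε > 0, ∃ F : E →L[ℂ] E,
    FiniteDimensional ℂ (F : E →ₗ[ℂ] E).range ∧ ‖K - F‖ < ε

/-- The image of the unit ball is totally bounded; compose `K` with the orthogonal projection onto
the span of a finite `ε/2`-net, which moves no point of the image by more than its distance to the
net. -/
theorem exists_finiteRank_approx {H : Type*} [NormedAddCommGroup H] [InnerProductSpace ℂ H]
    {K : E →L[ℂ] H} (hK : IsCompactOperator K) {ε : ℝ} (hε : 0 < ε) :
    ∃ F : E →L[ℂ] H, FiniteDimensional ℂ (F : E →ₗ[ℂ] H).range ∧ ‖K - F‖ < ε := by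
  obtain ⟨C, hC, hKC⟩ := IsCompactOperator.image_closedBall_subset_compact
    (f := (K : E →ₗ[ℂ] H)) hK 1
  obtain ⟨t, ht, hCt⟩ := Metric.totallyBounded_iff.1 hC.totallyBounded (ε / 2) (by positivity)
  let V : Submodule ℂ H := Submodule.span ℂ t
  have hV : FiniteDimensional ℂ V := FiniteDimensional.span_of_finite ℂ ht
  refine ⟨V.starProjection ∘L K, ?_, ?_⟩
  · refine Submodule.finiteDimensional_of_le (S₂ := V) ?_
    rintro _ ⟨x, rfl⟩
    exact V.starProjection_apply_mem (K x)
  · refine lt_of_le_of_lt ?_ (half_lt_self hε)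
    refine ContinuousLinearMap.opNorm_le_of_unit_norm (by positivity) fun x hx => ?_
    have hx' : K x ∈ ⋃ y ∈ t, Metric.ball y (ε / 2) :=
      hCt (hKC ⟨x, by simp [hx], rfl⟩)
    obtain ⟨y, hy, hxy⟩ := Set.mem_iUnion₂.1 hx'
    have hyV : y ∈ V := Submodule.subset_span hy
    calc ‖(K - V.starProjection ∘L K) x‖ = ‖K x - V.starProjection (K x)‖ := rfl
      _ = ⨅ v : V, ‖K x - v‖ := V.starProjection_minimal (K x)
      _ ≤ ‖K x - y‖ := ciInf_le ⟨0, by rintro _ ⟨v, rfl⟩; exact norm_nonneg _⟩ (⟨y, hyV⟩ : V)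
      _ ≤ ε / 2 := by rw [← dist_eq_norm]; exact (Metric.mem_ball.1 hxy).le

/-- `ι → H` carries the sup norm and is not a Hilbert space, so the approximation is made in each
coordinate separately. -/
theorem compactApprox_pi {ι H : Type*} [Fintype ι] [NormedAddCommGroup H] [InnerProductSpace ℂ H] :
    CompactApprox (ι → H) := by
  intro K hK ε hε
  let q (i : ι) : (ι → H) →L[ℂ] H := ContinuousLinearMap.proj i
  have h := fun i => exists_finiteRank_approx (K := q i ∘L K) (hK.clm_comp (q i)) (half_pos hε)
  choose F hF hKF using h
  refine ⟨ContinuousLinearMap.pi F, ?_, ?_⟩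
  · have := hF
    let f : (∀ i, (F i : (ι → H) →ₗ[ℂ] H).range) →ₗ[ℂ] (ι → H) :=
      LinearMap.pi fun i => Submodule.subtype _ ∘ₗ LinearMap.proj i
    refine Submodule.finiteDimensional_of_le (S₂ := f.range) ?_
    rintro _ ⟨x, rfl⟩
    exact ⟨fun i => ⟨F i x, x, rfl⟩, rfl⟩
  · refine lt_of_le_of_lt ?_ (half_lt_self hε)
    refine ContinuousLinearMap.opNorm_le_bound _ (by positivity) fun x => ?_
    refine (pi_norm_le_iff_of_nonneg (by positivity)).2 fun i => ?_
    exact ((q i ∘L K - F i).le_opNorm x).trans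
      (by gcongr; exact (hKF i).le)

variable [CompleteSpace E]

/-- The restriction of `1 + K`, `K` compact, to the range `Y` of a bounded projection. -/
theorem index_one_add_compact (hE : CompactApprox E) {Y : Submodule ℂ E} {p : E →L[ℂ] E}
    (hpY : ∀ x, p x ∈ Y) (hp : ∀ y ∈ Y, p y = y) {K : E →L[ℂ] E} (hK : IsCompactOperator K)
    {A : Y →ₗ[ℂ] Y} (hA : ∀ y, (A y : E) = y + K y) :
    A.index = 0 ∧ FiniteDimensional ℂ A.ker ∧ FiniteDimensional ℂ (Y ⧸ A.range) := by
  -- The tolerance gives `‖p (K - F)‖ < 1`, so that `1 + p(K - F)` is invertible by a Neumann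
  -- series; the `+ 1` covers `p = 0`.
  obtain ⟨F, hF, hKF⟩ := hE K hK (1 / (‖p‖ + 1)) (by positivity)
  let s : E →L[ℂ] E := p ∘L (K - F)
  have hs : ‖-s‖ < 1 := by
    rw [norm_neg]
    refine ((p.opNorm_comp_le (K - F)).trans
      (mul_le_mul_of_nonneg_left hKF.le (norm_nonneg p))).trans_lt ?_
    rw [mul_one_div, div_lt_one (by positivity)]
    linarith
  have hu : IsUnit (1 + s) := by
    simpa using isUnit_one_sub_of_norm_lt_one hs
  rw [ContinuousLinearMap.isUnit_iff_bijective] at hu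
  have hsY : ∀ x, s x ∈ Y := fun x => hpY _
  let u : Y →ₗ[ℂ] Y := LinearMap.restrict ((1 + s : E →L[ℂ] E) : E →ₗ[ℂ] E)
    (fun y hy => Y.add_mem hy (hsY y))
  have hu' : Function.Bijective u := by
    constructor
    · intro x y hxy
      exact Subtype.ext (hu.1 (congrArg Subtype.val hxy))
    · intro y
      obtain ⟨x, hx⟩ := hu.2 y
      have hx' : x + s x = y := hx
      -- A solution in `E` of `x + s x = y` lies in `Y`, because `s` takes its values in `Y`.
      have hxY : x ∈ Y := by
        rw [eq_sub_of_add_eq hx']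
        exact Y.sub_mem y.2 (hsY x)
      exact ⟨⟨x, hxY⟩, Subtype.ext hx⟩
  let G : Y →ₗ[ℂ] E := (F : E →ₗ[ℂ] E) ∘ₗ Y.subtype
  have hG : FiniteDimensional ℂ G.range :=
    Submodule.finiteDimensional_of_le (LinearMap.range_comp_le_range Y.subtype (F : E →ₗ[ℂ] E))
  have hN : FiniteDimensional ℂ (Y ⧸ G.ker) := Module.Finite.equiv G.quotKerEquivRange.symm
  refine index_eq_zero_of_eqOn (LinearEquiv.ofBijective u hu') G.ker fun y hy => ?_
  refine Subtype.ext ?_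
  have hy' : F y = 0 := hy
  -- Since `A` maps into `Y`, `p` fixes `y + K y` and therefore `K y`. So `A` agrees with `1 + p(K -
  -- F)` wherever `F` vanishes, a subspace of finite codimension.
  have h1 : p (y + K y) = y + K y := by rw [← hA]; exact hp _ (A y).2
  rw [map_add, hp y y.2] at h1
  calc (A y : E) = y + K y := hA y
    _ = y + p (K y) := h1.symm
    _ = y + s y := by simp [s, hy']

end FiniteRank

/-! ### Indices of compressed operators -/

section Compression

variable {E : Type*} [NormedAddCommGroup E] [NormedSpace ℂ E] [CompleteSpace E]

/-- Let `D` be an operator with compact resolvent `R = (D + i)⁻¹` that exchanges the two summands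
of a decomposition of the space defined by the projections `P` and `P'`, and let `e` be an
idempotent such that `C = [D, e]` is bounded. Then the index of the compression of `D + L`,
`L` bounded, to a map from `e (dom D ∩ ran P)` to `e (ran P')` does not depend on `L`. -/
theorem index_compression_eq (hE : CompactApprox E) {D : E →ₗ.[ℂ] E} {R P P' e C : E →L[ℂ] E}
    (hR : IsCompactOperator R) (hRD : ∀ y, ∃ h : R y ∈ D.domain, D ⟨R y, h⟩ + Complex.I • R y = y)
    (hDR : ∀ x : D.domain, R (D x + Complex.I • (x : E)) = x)
    (hP : ∀ x, P (P x) = P x) (hP' : ∀ x, P' (P' x) = P' x)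
    (hPD : ∀ x : D.domain, ∃ h : P x ∈ D.domain, D ⟨P x, h⟩ = P' (D x))
    (he : ∀ x, e (e x) = e x) (heP : ∀ x, e (P x) = P (e x)) (heP' : ∀ x, e (P' x) = P' (e x))
    (heD : ∀ x : D.domain, ∃ h : e x ∈ D.domain, D ⟨e x, h⟩ = e (D x) + C x)
    {X Y : Submodule ℂ E} (hX : ∀ x, x ∈ X ↔ x ∈ D.domain ∧ P x = x ∧ e x = x)
    (hY : ∀ y, y ∈ Y ↔ P' y = y ∧ e y = y)
    {L₁ L₂ : E →L[ℂ] E} {T₁ T₂ : X →ₗ[ℂ] Y}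
    (hT₁ : ∀ (x : X) (h : (x : E) ∈ D.domain), (T₁ x : E) = e (D ⟨x, h⟩ + L₁ x))
    (hT₂ : ∀ (x : X) (h : (x : E) ∈ D.domain), (T₂ x : E) = e (D ⟨x, h⟩ + L₂ x)) :
    T₁.index = T₂.index := by
  have hQX : ∀ y ∈ Y, e (P (R y)) ∈ X := fun y _ => by
    obtain ⟨h1, -⟩ := hRD y
    obtain ⟨h2, -⟩ := hPD ⟨R y, h1⟩
    obtain ⟨h3, -⟩ := heD ⟨P (R y), h2⟩
    exact (hX _).2 ⟨h3, by rw [← heP, hP], he _⟩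
  -- The parametrix does not involve `L`; this is why all indices coincide.
  let Q : Y →ₗ[ℂ] X := LinearMap.restrict ((e ∘L P ∘L R : E →L[ℂ] E) : E →ₗ[ℂ] E) hQX
  have key : ∀ (L : E →L[ℂ] E) (T : X →ₗ[ℂ] Y),
      (∀ (x : X) (h : (x : E) ∈ D.domain), (T x : E) = e (D ⟨x, h⟩ + L x)) →
      T.index = -Q.index := by
    intro L T hT
    -- Found by expanding `e(D + L)ePR`: moving `D` past `e` costs `CP`, moving it past `P` turns
    -- `P` into `P'`, and `DR = 1 - iR`.
    let K : E →L[ℂ] E := e ∘L (-(Complex.I • P') + C ∘L P + L ∘L e ∘L P) ∘L R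
    have hK : IsCompactOperator K :=
      hR.clm_comp (e ∘L (-(Complex.I • P') + C ∘L P + L ∘L e ∘L P))
    have hA : ∀ y, ((T ∘ₗ Q) y : E) = y + K y := by
      intro y
      obtain ⟨h1, h1'⟩ := hRD y
      obtain ⟨h2, h2'⟩ := hPD ⟨R y, h1⟩
      obtain ⟨h3, h3'⟩ := heD ⟨P (R y), h2⟩
      obtain ⟨hy, hy'⟩ := (hY y).1 y.2
      have hDRy : D ⟨R y, h1⟩ = y - Complex.I • R y := eq_sub_of_add_eq h1'
      calc (T (Q y) : E) = e (D ⟨e (P (R y)), h3⟩ + L (e (P (R y)))) := hT (Q y) h3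
        _ = y + K y := by
          rw [h3', h2', hDRy]
          simp only [map_add, map_sub, he, hy, hy', K, ContinuousLinearMap.comp_apply,
            add_apply, neg_apply, map_neg, map_smul,
            smul_apply]
          abel
    obtain ⟨h0, hk, hc⟩ := index_one_add_compact hE (p := e ∘L P')
      (fun x => (hY _).2 (by simp [← heP', he, hP']))
      (fun y hy => by simp [((hY y).1 hy).1, ((hY y).1 hy).2]) hK hA
    refine index_eq_neg_of_comp h0 hk hc ?_
    -- For `x = ex` in the kernel of `T`, `Dx = e(Dx) + Cx = Cx - e(Lx)`; applying `R` to `Dx + ix`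
    -- shows that `x` is fixed by the compact operator `M`.
    let M : E →L[ℂ] E := R ∘L (C - e ∘L L + Complex.I • ContinuousLinearMap.id ℂ E)
    have hM : IsCompactOperator M :=
      hR.comp_clm (C - e ∘L L + Complex.I • ContinuousLinearMap.id ℂ E)
    have hfix : ∀ x ∈ T.ker.map X.subtype, M x = x := by
      rintro _ ⟨x, hx, rfl⟩
      obtain ⟨h1, -, h3⟩ := (hX x).1 x.2
      obtain ⟨h4, h4'⟩ := heD ⟨x, h1⟩
      have hx0 : e (D ⟨x, h1⟩ + L x) = 0 := by
        rw [← hT x h1]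
        exact congrArg Subtype.val hx
      rw [map_add] at hx0
      have h5 : D ⟨x, h1⟩ = e (D ⟨x, h1⟩) + C x := by
        rw [← h4']
        congr 1
        exact Subtype.ext h3.symm
      have h6 : D ⟨x, h1⟩ = C x - e (L x) := by
        rw [h5, eq_neg_of_add_eq_zero_left hx0]
        abel
      have h7 := hDR ⟨x, h1⟩
      rw [h6] at h7
      simpa [M] using h7
    have := finiteDimensional_of_compact_fixed hM _ hfix
    exact Module.Finite.equiv (Submodule.equivMapOfInjective X.subtype X.injective_subtype
      T.ker).symm
  rw [key L₁ T₁ hT₁, key L₂ T₂ hT₂]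

end Compression

/-! ### Amplifications -/

section Amplification

variable {H : Type*} [NormedAddCommGroup H] [InnerProductSpace ℂ H] {ι : Type*}

/-- The operator `A ⊗ 1` on `H^q`. -/
def amp (ι : Type*) (A : H →L[ℂ] H) : (ι → H) →L[ℂ] (ι → H) :=
  ContinuousLinearMap.piMap fun _ => A

theorem amp_apply (A : H →L[ℂ] H) (x : ι → H) (i : ι) : amp ι A x i = A (x i) := rfl

/-- The operator `D ⊗ 1` on `(dom D)^q`. -/
def ampPMap (ι : Type*) (D : H →ₗ.[ℂ] H) : (ι → H) →ₗ.[ℂ] (ι → H) where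
  domain := Submodule.pi Set.univ fun _ => D.domain
  toFun := LinearMap.pi fun i => D.toFun ∘ₗ LinearMap.codRestrict D.domain
    (LinearMap.proj i ∘ₗ Submodule.subtype _) (fun x => Submodule.mem_pi.1 x.2 i trivial)

theorem mem_ampPMap_domain {D : H →ₗ.[ℂ] H} {x : ι → H} :
    x ∈ (ampPMap ι D).domain ↔ ∀ i, x i ∈ D.domain := by
  simp [ampPMap]

theorem ampPMap_apply (D : H →ₗ.[ℂ] H) (x : (ampPMap ι D).domain) (i : ι) :
    ampPMap ι D x i = D ⟨(x : ι → H) i, mem_ampPMap_domain.1 x.2 i⟩ := rfl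

variable [Fintype ι]

theorem isCompactOperator_amp {A : H →L[ℂ] H} (hA : IsCompactOperator A) :
    IsCompactOperator (amp ι A) := by
  classical
  let q (i : ι) : (ι → H) →L[ℂ] H := ContinuousLinearMap.proj i
  let j (i : ι) : H →L[ℂ] (ι → H) := ContinuousLinearMap.single ℂ (fun _ => H) i
  have h : amp ι A = ∑ i, j i ∘L A ∘L q i := by
    ext x i
    simp [amp_apply, j, q, Finset.sum_apply, Pi.single_apply]
  have hmem : ∑ i, j i ∘L A ∘L q i ∈ compactOperator (RingHom.id ℂ) (ι → H) (ι → H) :=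
    Submodule.sum_mem _ fun i _ => (hA.comp_clm (q i)).clm_comp (j i)
  rw [h]
  exact hmem

/-- The action on `H^q` of a matrix of bounded operators. -/
def opAct (M : Matrix ι ι (H →L[ℂ] H)) : (ι → H) →L[ℂ] (ι → H) :=
  ContinuousLinearMap.pi fun i => ∑ j, M i j ∘L ContinuousLinearMap.proj j

theorem opAct_apply (M : Matrix ι ι (H →L[ℂ] H)) (x : ι → H) (i : ι) :
    opAct M x i = ∑ j, M i j (x j) := by
  simp [opAct]

variable {B : Type*} [Ring B] [Algebra ℂ B]

theorem matAct_apply (π : B →ₐ[ℂ] (H →L[ℂ] H)) (M : Matrix ι ι B) (x : ι → H) (i : ι) :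
    matAct π M x i = ∑ j, π (M i j) (x j) := by
  simp [matAct]

theorem matAct_mul (π : B →ₐ[ℂ] (H →L[ℂ] H)) (M N : Matrix ι ι B) (x : ι → H) :
    matAct π (M * N) x = matAct π M (matAct π N x) := by
  ext i
  simp only [matAct_apply, Matrix.mul_apply, map_sum, map_mul, sum_apply,
    mul_apply_eq_comp]
  exact Finset.sum_comm

theorem opAct_map (π : B →ₐ[ℂ] (H →L[ℂ] H)) (M : Matrix ι ι B) (x : ι → H) :
    opAct (M.map π) x = matAct π M x := by
  ext i
  simp [opAct_apply, matAct_apply]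

end Amplification

/-! ### Gradings and bounded commutators -/

section Grading

variable {H : Type*} [NormedAddCommGroup H] [InnerProductSpace ℂ H] {S : Submodule ℂ H}

theorem IsEven.mul {T U : H →L[ℂ] H} (hT : IsEven S T) (hU : IsEven S U) : IsEven S (T * U) :=
  ⟨fun x hx => hT.1 _ (hU.1 x hx), fun x hx => hT.2 _ (hU.2 x hx)⟩

theorem IsEven.add {T U : H →L[ℂ] H} (hT : IsEven S T) (hU : IsEven S U) : IsEven S (T + U) :=
  ⟨fun x hx => S.add_mem (hT.1 x hx) (hU.1 x hx),
    fun x hx => Sᗮ.add_mem (hT.2 x hx) (hU.2 x hx)⟩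

theorem unit_apply_inv_apply (u : (H →L[ℂ] H)ˣ) (x : H) :
    (u : H →L[ℂ] H) (((u⁻¹ : (H →L[ℂ] H)ˣ) : H →L[ℂ] H) x) = x := by
  rw [← mul_apply_eq_comp, Units.mul_inv]
  rfl

theorem unit_inv_apply_apply (u : (H →L[ℂ] H)ˣ) (x : H) :
    ((u⁻¹ : (H →L[ℂ] H)ˣ) : H →L[ℂ] H) ((u : H →L[ℂ] H) x) = x := by
  rw [← mul_apply_eq_comp, Units.inv_mul]
  rfl

variable [S.HasOrthogonalProjection]

theorem IsEven.orthogonal {T : H →L[ℂ] H} (hT : IsEven S T) : IsEven Sᗮ T :=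
  ⟨hT.2, by rw [Submodule.orthogonal_orthogonal]; exact hT.1⟩

theorem IsOdd.orthogonal {D : H →ₗ.[ℂ] H} (hD : IsOdd S D) : IsOdd Sᗮ D where
  domain_splits := by
    rw [Submodule.orthogonal_orthogonal, sup_comm]
    exact hD.domain_splits
  map_plus := by
    rw [Submodule.orthogonal_orthogonal]
    exact hD.map_minus
  map_minus := by
    rw [Submodule.orthogonal_orthogonal]
    exact hD.map_plus

theorem eq_starProjection_add (S : Submodule ℂ H) [S.HasOrthogonalProjection] (x : H) :
    x = S.starProjection x + Sᗮ.starProjection x :=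
  (Submodule.starProjection_add_starProjection_orthogonal x).symm

theorem IsEven.starProjection {T : H →L[ℂ] H} (hT : IsEven S T) (x : H) :
    T (S.starProjection x) = S.starProjection (T x) := by
  have h1 := hT.1 _ (S.starProjection_apply_mem x)
  have h2 := hT.2 _ (Sᗮ.starProjection_apply_mem x)
  conv_rhs => rw [eq_starProjection_add S x, map_add, map_add,
    Submodule.starProjection_eq_self_iff.2 h1, (S.starProjection_apply_eq_zero_iff).2 h2, add_zero]

/-- An even operator commutes with the projection onto `S`, so injectivity of `u` reflects
membership in `S`. Consequently inverses of even units are even. -/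
theorem IsEven.unit_mem_iff {u : (H →L[ℂ] H)ˣ} (hu : IsEven S (u : H →L[ℂ] H)) (x : H) :
    (u : H →L[ℂ] H) x ∈ S ↔ x ∈ S := by
  refine ⟨fun h => ?_, hu.1 x⟩
  rw [← Submodule.starProjection_eq_self_iff, ← hu.starProjection] at h
  have h' := congrArg ((u⁻¹ : (H →L[ℂ] H)ˣ) : H →L[ℂ] H) h
  rw [unit_inv_apply_apply, unit_inv_apply_apply] at h'
  exact Submodule.starProjection_eq_self_iff.1 h'

theorem IsEven.units_inv {u : (H →L[ℂ] H)ˣ} (hu : IsEven S (u : H →L[ℂ] H)) :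
    IsEven S ((u⁻¹ : (H →L[ℂ] H)ˣ) : H →L[ℂ] H) :=
  ⟨fun x hx => (hu.unit_mem_iff _).1 (by rwa [unit_apply_inv_apply]),
    fun x hx => (hu.orthogonal.unit_mem_iff _).1 (by rwa [unit_apply_inv_apply])⟩

/-- The splitting of the domain must be the orthogonal one, so the projection onto `S` preserves
`dom D` and `D` intertwines it with the projection onto `Sᗮ`. -/
theorem IsOdd.starProjection {D : H →ₗ.[ℂ] H} (hD : IsOdd S D) (x : D.domain) :
    ∃ h : S.starProjection x ∈ D.domain, D ⟨S.starProjection x, h⟩ = Sᗮ.starProjection (D x) := by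
  obtain ⟨u, hu, v, hv, huv⟩ := Submodule.mem_sup.1 (hD.domain_splits x.2)
  have hx : S.starProjection (x : H) = u := by
    rw [← huv, map_add, Submodule.starProjection_eq_self_iff.2 hu.2,
      (S.starProjection_apply_eq_zero_iff).2 hv.2, add_zero]
  have huD := (Submodule.mem_inf.1 hu).1
  have hvD := (Submodule.mem_inf.1 hv).1
  have hx' : D x = D ⟨u, huD⟩ + D ⟨v, hvD⟩ := by
    rw [← D.map_add]
    exact congrArg D (Subtype.ext huv.symm)
  have h1 := hD.map_plus ⟨u, huD⟩ hu.2
  have h2 := hD.map_minus ⟨v, hvD⟩ hv.2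
  have h3 : Sᗮ.starProjection (D x) = D ⟨u, huD⟩ := by
    rw [hx', map_add, Submodule.starProjection_eq_self_iff.2 h1,
      (Sᗮ.starProjection_apply_eq_zero_iff).2 (by rwa [Submodule.orthogonal_orthogonal]), add_zero]
  refine ⟨hx ▸ huD, ?_⟩
  rw [h3]
  congr 1
  exact Subtype.ext hx

/-- The bounded operator `C` extends the commutator `[D, T]`, where `T` preserves `dom D`. -/
def IsCommutator (D : H →ₗ.[ℂ] H) (T C : H →L[ℂ] H) : Prop :=
  ∀ x : D.domain, ∃ h : T x ∈ D.domain, D ⟨T x, h⟩ = T (D x) + C x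

theorem IsCommutator.mul {D : H →ₗ.[ℂ] H} {T U C C' : H →L[ℂ] H} (h : IsCommutator D T C)
    (h' : IsCommutator D U C') : IsCommutator D (T * U) (T * C' + C * U) := by
  intro x
  obtain ⟨h1, h1'⟩ := h' x
  obtain ⟨h2, h2'⟩ := h ⟨U x, h1⟩
  refine ⟨h2, h2'.trans ?_⟩
  rw [h1', map_add, add_assoc]
  rfl

theorem IsCommutator.add {D : H →ₗ.[ℂ] H} {T U C C' : H →L[ℂ] H} (h : IsCommutator D T C)
    (h' : IsCommutator D U C') : IsCommutator D (T + U) (C + C') := by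
  intro x
  obtain ⟨h1, h1'⟩ := h' x
  obtain ⟨h2, h2'⟩ := h x
  refine ⟨D.domain.add_mem h2 h1, ?_⟩
  have : D ⟨(T + U) x, D.domain.add_mem h2 h1⟩ = D ⟨T x, h2⟩ + D ⟨U x, h1⟩ :=
    map_add D.toFun ⟨T x, h2⟩ ⟨U x, h1⟩
  rw [this, h1', h2']
  simp only [add_apply]
  abel

/-- `[D, T]` is bounded on a dense subspace and extends by continuity to all of `H`. -/
theorem exists_isCommutator [CompleteSpace H] {D : H →ₗ.[ℂ] H} {T : H →L[ℂ] H}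
    (hD : Dense (D.domain : Set H))
    (hT : ∀ x ∈ D.domain, T x ∈ D.domain) {c : ℝ}
    (hc : ∀ (x : D.domain) (h : T x ∈ D.domain), ‖D ⟨T x, h⟩ - T (D x)‖ ≤ c * ‖(x : H)‖) :
    ∃ C : H →L[ℂ] H, IsCommutator D T C := by
  let f : D.domain →ₗ[ℂ] H :=
    D.toFun ∘ₗ LinearMap.restrict (T : H →ₗ[ℂ] H) hT - (T : H →ₗ[ℂ] H) ∘ₗ D.toFun
  let F : D.domain →L[ℂ] H := f.mkContinuous c fun x => hc x (hT x x.2)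
  refine ⟨F.extend D.domain.subtypeL, fun x => ⟨hT x x.2, ?_⟩⟩
  have h : F.extend D.domain.subtypeL x = F x :=
    ContinuousLinearMap.extend_eq _ hD.denseRange_val
      isUniformEmbedding_subtype_val.isUniformInducing x
  rw [h]
  exact (add_sub_cancel _ _).symm

end Grading

/-! ### The index of the conjugated Dirac operator -/

section ChiralIndex

variable {H : Type*} [NormedAddCommGroup H] [InnerProductSpace ℂ H]
  {B : Type*} [Ring B] [Algebra ℂ B] {ι : Type*}

theorem rep_apply_apply (π : B →ₐ[ℂ] (H →L[ℂ] H)) (b c : B) (x : H) :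
    π b (π c x) = π (b * c) x := by
  rw [map_mul, mul_apply_eq_comp]

/-- The isomorphism `u ⊗ 1` of `H^q`. -/
def ampEquiv (ι : Type*) (u : (H →L[ℂ] H)ˣ) : (ι → H) ≃ₗ[ℂ] (ι → H) :=
  LinearEquiv.piCongrRight fun _ => (ContinuousLinearEquiv.ofUnit u).toLinearEquiv

theorem ampEquiv_apply (u : (H →L[ℂ] H)ˣ) (x : ι → H) (i : ι) :
    ampEquiv ι u x i = (u : H →L[ℂ] H) (x i) := rfl

variable [Fintype ι]

theorem mem_twDom {π : B →ₐ[ℂ] (H →L[ℂ] H)} {D : H →ₗ.[ℂ] H} {S : Submodule ℂ H}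
    {e : Matrix ι ι B} (he : e * e = e) {x : ι → H} :
    x ∈ twDom π D S e ↔ (∀ i, x i ∈ D.domain ∧ x i ∈ S) ∧ matAct π e x = x := by
  simp only [twDom, Submodule.mem_inf, Submodule.mem_pi, Set.mem_univ, forall_const,
    LinearMap.mem_range]
  refine and_congr_right fun _ => ⟨?_, fun h => ⟨x, h⟩⟩
  rintro ⟨y, rfl⟩
  rw [← matAct_mul, he]

theorem twDirac_mem_twTarget {π : B →ₐ[ℂ] (H →L[ℂ] H)} {D : H →ₗ.[ℂ] H} (σ : B ≃ₐ[ℂ] B)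
    {S S' : Submodule ℂ H} (hD : ∀ x : D.domain, (x : H) ∈ S → D x ∈ S') (e : Matrix ι ι B)
    (x : twDom π D S e) : twDirac π D σ S e x ∈ twTarget π σ S' e := by
  refine ⟨_, ?_, rfl⟩
  exact Submodule.mem_pi.2 fun i _ => hD _
    (Submodule.mem_inf.1 (Submodule.mem_pi.1 (Submodule.mem_inf.1 x.2).1 i (Set.mem_univ i))).2

/-- Makes the general facts on the index of linear maps, in particular its additivity under
composition, available for `chiralIndex`. -/
theorem chiralIndex_eq_index {π : B →ₐ[ℂ] (H →L[ℂ] H)} {D : H →ₗ.[ℂ] H} (σ : B ≃ₐ[ℂ] B)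
    {S S' : Submodule ℂ H} (hD : ∀ x : D.domain, (x : H) ∈ S → D x ∈ S') (e : Matrix ι ι B) :
    chiralIndex π D σ S S' e = ((twDirac π D σ S e).codRestrict (twTarget π σ S' e)
      (twDirac_mem_twTarget σ hD e)).index := by
  rw [LinearMap.index_eq_finrank_sub, LinearMap.ker_codRestrict, LinearMap.range_codRestrict]
  rfl

theorem matAct_mem {π : B →ₐ[ℂ] (H →L[ℂ] H)} {S : Submodule ℂ H}
    (hπ : ∀ b, ∀ x ∈ S, π b x ∈ S) (e : Matrix ι ι B) {x : ι → H} (hx : ∀ i, x i ∈ S) (i : ι) :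
    matAct π e x i ∈ S := by
  rw [matAct_apply]
  exact S.sum_mem fun j _ => hπ _ _ (hx j)

theorem mem_twTarget {π : B →ₐ[ℂ] (H →L[ℂ] H)} {S : Submodule ℂ H}
    (hπ : ∀ b, ∀ x ∈ S, π b x ∈ S) {e : Matrix ι ι B} (he : e * e = e) {x : ι → H} :
    x ∈ twTarget π AlgEquiv.refl S e ↔ (∀ i, x i ∈ S) ∧ matAct π e x = x := by
  have h : e.map (AlgEquiv.refl : B ≃ₐ[ℂ] B) = e := by ext; rfl
  simp only [twTarget, h, Submodule.mem_map, Submodule.mem_pi, Set.mem_univ, forall_const]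
  constructor
  · rintro ⟨y, hy, rfl⟩
    exact ⟨matAct_mem hπ e hy, by rw [← matAct_mul, he]⟩
  · rintro ⟨hx, hx'⟩
    exact ⟨x, hx, hx'⟩

/-- The intertwining relation holds only on `S`, so it is applied entry by entry to vectors with all
coordinates in `S`. The map `τ` is the identity for the source of the Dirac operator and `σ` for its
target. -/
theorem ampEquiv_matAct {π : B →ₐ[ℂ] (H →L[ℂ] H)} {S : Submodule ℂ H} {u : (H →L[ℂ] H)ˣ}
    {τ : B → B}
    (hu : ∀ b, ∀ x ∈ S, (u : H →L[ℂ] H) (π (τ b) x) = π b ((u : H →L[ℂ] H) x))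
    (e : Matrix ι ι B) {x : ι → H} (hx : ∀ i, x i ∈ S) :
    ampEquiv ι u (matAct π (e.map τ) x) = matAct π e (ampEquiv ι u x) := by
  ext i
  simp only [ampEquiv_apply, matAct_apply, map_sum, Matrix.map_apply, hu _ _ (hx _)]

theorem ampEquiv_map_twDom {π : B →ₐ[ℂ] (H →L[ℂ] H)} {D : H →ₗ.[ℂ] H} {S : Submodule ℂ H}
    {u : (H →L[ℂ] H)ˣ} (huS : ∀ x, (u : H →L[ℂ] H) x ∈ S ↔ x ∈ S)
    (huD : ∀ x, (u : H →L[ℂ] H) x ∈ D.domain ↔ x ∈ D.domain)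
    (hu : ∀ b, ∀ x ∈ S, (u : H →L[ℂ] H) (π b x) = π b ((u : H →L[ℂ] H) x))
    {e : Matrix ι ι B} (he : e * e = e) :
    (twDom π D S e).map (ampEquiv ι u : (ι → H) →ₗ[ℂ] (ι → H)) = twDom π D S e := by
  ext x
  obtain ⟨x, rfl⟩ := (ampEquiv ι u).surjective x
  have h1 : ampEquiv ι u x ∈ (twDom π D S e).map (ampEquiv ι u : (ι → H) →ₗ[ℂ] (ι → H)) ↔
      x ∈ twDom π D S e := by
    simp
  rw [h1, mem_twDom he, mem_twDom he]
  simp only [ampEquiv_apply, huS, huD]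
  refine and_congr_right fun hx => ?_
  have h2 := ampEquiv_matAct (τ := id) hu e fun i => (hx i).2
  rw [Matrix.map_id] at h2
  rw [← h2, (ampEquiv ι u).injective.eq_iff]

theorem ampEquiv_map_twTarget {π : B →ₐ[ℂ] (H →L[ℂ] H)} {S : Submodule ℂ H} {σ : B ≃ₐ[ℂ] B}
    {u : (H →L[ℂ] H)ˣ} (huS : ∀ x, (u : H →L[ℂ] H) x ∈ S ↔ x ∈ S)
    (hu : ∀ b, ∀ x ∈ S, (u : H →L[ℂ] H) (π (σ b) x) = π b ((u : H →L[ℂ] H) x))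
    (e : Matrix ι ι B) :
    (twTarget π σ S e).map (ampEquiv ι u : (ι → H) →ₗ[ℂ] (ι → H)) =
      twTarget π AlgEquiv.refl S e := by
  have h : e.map (AlgEquiv.refl : B ≃ₐ[ℂ] B) = e := by ext; rfl
  ext x
  simp only [twTarget, h, Submodule.mem_map, Submodule.mem_pi, Set.mem_univ, forall_const,
    LinearEquiv.coe_coe]
  constructor
  · rintro ⟨_, ⟨y, hy, rfl⟩, rfl⟩
    exact ⟨ampEquiv ι u y, fun i => (huS _).2 (hy i), (ampEquiv_matAct hu e hy).symm⟩
  · rintro ⟨y, hy, rfl⟩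
    obtain ⟨y, rfl⟩ := (ampEquiv ι u).surjective y
    have hy' : ∀ i, y i ∈ S := fun i => (huS _).1 (hy i)
    exact ⟨_, ⟨y, hy', rfl⟩, ampEquiv_matAct hu e hy'⟩

theorem exists_commutator_matAct {π : B →ₐ[ℂ] (H →L[ℂ] H)} {D : H →ₗ.[ℂ] H}
    (hC : ∀ b, ∃ C : H →L[ℂ] H, IsCommutator D (π b) C) (e : Matrix ι ι B) :
    ∃ C : (ι → H) →L[ℂ] (ι → H), ∀ x : (ampPMap ι D).domain,
      ∃ h : opAct (e.map π) x ∈ (ampPMap ι D).domain,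
        ampPMap ι D ⟨opAct (e.map π) x, h⟩ = opAct (e.map π) (ampPMap ι D x) + C x := by
  choose C hC using hC
  refine ⟨opAct (e.map C), fun x => ?_⟩
  have hx := mem_ampPMap_domain.1 x.2
  have h1 : ∀ i j, π (e i j) ((x : ι → H) j) ∈ D.domain := fun i j =>
    (hC (e i j) ⟨_, hx j⟩).1
  have h2 : ∀ i j, D ⟨_, h1 i j⟩ = π (e i j) (D ⟨_, hx j⟩) + C (e i j) ((x : ι → H) j) :=
    fun i j => (hC (e i j) ⟨_, hx j⟩).2
  have h3 : opAct (e.map π) x ∈ (ampPMap ι D).domain := by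
    refine mem_ampPMap_domain.2 fun i => ?_
    rw [opAct_apply]
    exact D.domain.sum_mem fun j _ => h1 i j
  refine ⟨h3, funext fun i => ?_⟩
  have h4 : (⟨opAct (e.map π) x i, mem_ampPMap_domain.1 h3 i⟩ : D.domain) =
      ∑ j, ⟨_, h1 i j⟩ := by
    refine Subtype.ext ?_
    simp [opAct_apply]
  rw [ampPMap_apply, h4, Pi.add_apply, opAct_apply, opAct_apply, ← Finset.sum_add_distrib]
  refine (map_sum D.toFun _ _).trans (Finset.sum_congr rfl fun j _ => ?_)
  exact h2 i j

variable [CompleteSpace H]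

/-- Twisting `D` to `ω D ω` and the representation by the inner automorphism `σ` does not change
the index of the compressions. -/
theorem chiralIndex_conjDirac {S : Submodule ℂ H} [S.HasOrthogonalProjection]
    {π : B →ₐ[ℂ] (H →L[ℂ] H)} {D : H →ₗ.[ℂ] H} (hodd : IsOdd S D)
    (hres : HasCompactResolvent D) (hπ : ∀ b, IsEven S (π b))
    (hC : ∀ b, ∃ C : H →L[ℂ] H, IsCommutator D (π b) C) {ω : (H →L[ℂ] H)ˣ}
    (hω : IsEven S (ω : H →L[ℂ] H)) (hωD : ∀ x, (ω : H →L[ℂ] H) x ∈ D.domain ↔ x ∈ D.domain)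
    {g g' : Bˣ} {σ : B ≃ₐ[ℂ] B} (hσ : ∀ b, g' * g * b = σ b * (g' * g))
    (htw : ∀ b, ∀ x ∈ S, (ω : H →L[ℂ] H) (π b x) = π (g * b * (g⁻¹ : Bˣ)) ((ω : H →L[ℂ] H) x))
    (htw' : ∀ b, ∀ x ∈ Sᗮ,
      (ω : H →L[ℂ] H) (π b x) = π (g' * b * (g'⁻¹ : Bˣ)) ((ω : H →L[ℂ] H) x))
    {e : Matrix ι ι B} (he : e * e = e) :
    chiralIndex π (conjDirac D (ω : H →L[ℂ] H) hωD) σ S Sᗮ e =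
      chiralIndex π D AlgEquiv.refl S Sᗮ e := by
  let D' := conjDirac D (ω : H →L[ℂ] H) hωD
  have hodd' : ∀ x : D'.domain, (x : H) ∈ S → D' x ∈ Sᗮ := fun x hx =>
    hω.2 _ (hodd.map_plus ⟨_, (hωD x).2 x.2⟩ (hω.1 _ hx))
  -- the unit `π(g)⁻¹`
  let γ : (H →L[ℂ] H)ˣ := Units.map (π : B →* (H →L[ℂ] H)) g⁻¹
  have hγ : (γ : H →L[ℂ] H) = π (g⁻¹ : Bˣ) := rfl
  have hγS : IsEven S (γ : H →L[ℂ] H) := hπ _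
  have hγD : ∀ x, (γ : H →L[ℂ] H) x ∈ D.domain ↔ x ∈ D.domain := by
    have h1 : ∀ b, ∀ x ∈ D.domain, π b x ∈ D.domain := fun b x hx =>
      ((hC b).choose_spec ⟨x, hx⟩).1
    refine fun x => ⟨fun h => ?_, fun h => h1 _ x h⟩
    have h2 := h1 g _ h
    rwa [hγ, rep_apply_apply, Units.mul_inv, map_one] at h2
  -- `α` corrects `ω` so as to commute with the algebra on `S`; `β` untwists `σ` on `Sᗮ`. The same
  -- factor `g⁻¹` serves both, since `ω⁻¹` already undoes the `g'` part of `σ`.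
  let α : (H →L[ℂ] H)ˣ := γ * ω
  let β : (H →L[ℂ] H)ˣ := γ * ω⁻¹
  have hα : ∀ x, (α : H →L[ℂ] H) x = π (g⁻¹ : Bˣ) ((ω : H →L[ℂ] H) x) := fun x => rfl
  have hβ : ∀ x, (β : H →L[ℂ] H) x =
    π (g⁻¹ : Bˣ) (((ω⁻¹ : (H →L[ℂ] H)ˣ) : H →L[ℂ] H) x) := fun x => rfl
  have hαS : IsEven S (α : H →L[ℂ] H) := hγS.mul hω
  have hβS : IsEven S (β : H →L[ℂ] H) := hγS.mul hω.units_inv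
  have hαD : ∀ x, (α : H →L[ℂ] H) x ∈ D.domain ↔ x ∈ D.domain := fun x =>
    (hγD _).trans (hωD x)
  have hαπ : ∀ b, ∀ x ∈ S, (α : H →L[ℂ] H) (π b x) = π b ((α : H →L[ℂ] H) x) := by
    intro b x hx
    rw [hα, hα, htw b x hx, rep_apply_apply, rep_apply_apply]
    simp [mul_assoc]
  have hβπ : ∀ b, ∀ x ∈ Sᗮ, (β : H →L[ℂ] H) (π (σ b) x) = π b ((β : H →L[ℂ] H) x) := by
    intro b x hx
    have h1 := htw' (g * b * (g⁻¹ : Bˣ)) _ (hω.units_inv.2 x hx)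
    have h2 : (g' : B) * (g * b * (g⁻¹ : Bˣ)) * (g'⁻¹ : Bˣ) = σ b := by
      calc (g' : B) * (g * b * (g⁻¹ : Bˣ)) * (g'⁻¹ : Bˣ)
          = g' * g * b * ((g⁻¹ : Bˣ) * (g'⁻¹ : Bˣ)) := by simp only [mul_assoc]
        _ = σ b := by rw [hσ]; simp [mul_assoc]
    rw [h2, unit_apply_inv_apply] at h1
    rw [hβ, hβ, ← h1, unit_inv_apply_apply, rep_apply_apply, rep_apply_apply]
    simp [mul_assoc]
  rw [chiralIndex_eq_index σ hodd', chiralIndex_eq_index AlgEquiv.refl hodd.map_plus]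
  let A : twDom π D S e ≃ₗ[ℂ] twDom π D S e := LinearEquiv.ofSubmodules (ampEquiv ι α) _ _
    (ampEquiv_map_twDom (fun x => hαS.unit_mem_iff x) hαD hαπ he)
  let A' : twTarget π σ Sᗮ e ≃ₗ[ℂ] twTarget π AlgEquiv.refl Sᗮ e :=
    LinearEquiv.ofSubmodules (ampEquiv ι β) _ _
      (ampEquiv_map_twTarget (fun x => hβS.orthogonal.unit_mem_iff x) hβπ e)
  let T : twDom π D S e →ₗ[ℂ] twTarget π σ Sᗮ e :=
    (twDirac π D' σ S e).codRestrict (twTarget π σ Sᗮ e) (twDirac_mem_twTarget σ hodd' e)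
  -- After the change of coordinates by `α` and `β`, the operator becomes `e g⁻¹ D g`, with the
  -- source and target of the untwisted one.
  let T₁ : twDom π D S e →ₗ[ℂ] twTarget π AlgEquiv.refl Sᗮ e :=
    (A' : _ →ₗ[ℂ] _) ∘ₗ T ∘ₗ (A.symm : _ →ₗ[ℂ] _)
  have hT : T.index = T₁.index := index_eq_of_intertwine A A' fun x => by simp [T₁]
  refine hT.trans ?_
  obtain ⟨R, hR, hRD, hDR⟩ := hres
  obtain ⟨C, hCe⟩ := exists_commutator_matAct hC e
  obtain ⟨G, hG⟩ := hC g
  -- `g⁻¹Dg = D + g⁻¹[D, g]`, so this is the bounded perturbation; the untwisted operator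
  -- corresponds to the perturbation `0`.
  let L : H →L[ℂ] H := π (g⁻¹ : Bˣ) ∘L G
  have hDg : ∀ (x : H) (h : x ∈ D.domain) (h' : π g x ∈ D.domain),
      π (g⁻¹ : Bˣ) (D ⟨π g x, h'⟩) = D ⟨x, h⟩ + L x := by
    intro x h h'
    obtain ⟨h1, h2⟩ := hG ⟨x, h⟩
    rw [h2, map_add, rep_apply_apply, Units.inv_mul, map_one]
    rfl
  have hpi : ∀ (V : Submodule ℂ H) [V.HasOrthogonalProjection] (x : ι → H),
      amp ι V.starProjection x = x ↔ ∀ i, x i ∈ V := by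
    intro V _ x
    simp only [funext_iff, amp_apply, Submodule.starProjection_eq_self_iff]
  have hpe : ∀ (V : Submodule ℂ H) [V.HasOrthogonalProjection], (∀ b, IsEven V (π b)) →
      ∀ x, opAct (e.map π) (amp ι V.starProjection x) =
        amp ι V.starProjection (opAct (e.map π) x) := by
    intro V _ hV x
    ext i
    simp only [amp_apply, opAct_apply, map_sum, Matrix.map_apply, (hV _).starProjection]
  refine index_compression_eq compactApprox_pi (D := ampPMap ι D) (R := amp ι R)
    (P := amp ι S.starProjection) (P' := amp ι Sᗮ.starProjection) (e := opAct (e.map π)) (C := C)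
    (L₁ := amp ι L) (L₂ := 0) (isCompactOperator_amp hR) ?_ ?_ ?_ ?_ ?_ ?_ (hpe S hπ)
    (hpe Sᗮ fun b => (hπ b).orthogonal) hCe ?_ ?_ ?_ ?_
  · intro y
    choose h h' using hRD
    exact ⟨mem_ampPMap_domain.2 fun i => h (y i), funext fun i => h' (y i)⟩
  · exact fun x => funext fun i => hDR ⟨_, mem_ampPMap_domain.1 x.2 i⟩
  · exact fun x => (hpi S _).2 fun i => S.starProjection_apply_mem _
  · exact fun x => (hpi Sᗮ _).2 fun i => Sᗮ.starProjection_apply_mem _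
  · intro x
    have h := fun i => hodd.starProjection ⟨_, mem_ampPMap_domain.1 x.2 i⟩
    choose h h' using h
    exact ⟨mem_ampPMap_domain.2 h, funext h'⟩
  · intro x
    rw [opAct_map, opAct_map, ← matAct_mul, he]
  · intro x
    rw [mem_twDom he, mem_ampPMap_domain, hpi, opAct_map, ← and_assoc, forall_and]
  · intro y
    rw [mem_twTarget (fun b => (hπ b).2) he, hpi, opAct_map]
  · intro x hx
    obtain ⟨z, rfl⟩ := A.surjective x
    have hz : ∀ i, (z : ι → H) i ∈ D'.domain ∧ (z : ι → H) i ∈ S := ((mem_twDom he).1 z.2).1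
    have h1 : (T₁ (A z) : ι → H) = ampEquiv ι β (matAct π (e.map σ)
        (fun i => D' ⟨(z : ι → H) i, (hz i).1⟩)) := by
      simp only [T₁, LinearMap.comp_apply, LinearEquiv.coe_coe, LinearEquiv.symm_apply_apply]
      rfl
    rw [h1, ampEquiv_matAct hβπ e fun i => hodd' _ (hz i).2, opAct_map]
    congr 1
    ext i
    have h2 : (A z : ι → H) i = (α : H →L[ℂ] H) ((z : ι → H) i) := rfl
    have h3 : π g ((A z : ι → H) i) = (ω : H →L[ℂ] H) ((z : ι → H) i) := by
      rw [h2, hα, rep_apply_apply, Units.mul_inv, map_one]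
      rfl
    have h4 : (ω : H →L[ℂ] H) ((z : ι → H) i) ∈ D.domain := (hωD _).2 (hz i).1
    have h5 := hDg _ (mem_ampPMap_domain.1 hx i) (h3 ▸ h4)
    have h6 : D' ⟨(z : ι → H) i, (hz i).1⟩ = (ω : H →L[ℂ] H) (D ⟨_, h4⟩) := rfl
    rw [Pi.add_apply, amp_apply, ampPMap_apply, ← h5, ampEquiv_apply, hβ, h6,
      unit_inv_apply_apply]
    congr 2
    exact Subtype.ext h3.symm
  · intro x hx
    have h : e.map (AlgEquiv.refl : B ≃ₐ[ℂ] B) = e := by ext; rfl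
    rw [opAct_map]
    change matAct π (e.map (AlgEquiv.refl : B ≃ₐ[ℂ] B)) _ = _
    rw [h]
    congr 1
    exact (add_zero _).symm

end ChiralIndex

/-! ### The twisted spectral triple of the conjugated Dirac operator -/

section ConjDirac

variable {H : Type*} [NormedAddCommGroup H] [InnerProductSpace ℂ H]
  {D : H →ₗ.[ℂ] H} {ω : (H →L[ℂ] H)ˣ}

theorem conjDirac_coe_apply (hωD : ∀ x, (ω : H →L[ℂ] H) x ∈ D.domain ↔ x ∈ D.domain)
    (x : (conjDirac D (ω : H →L[ℂ] H) hωD).domain) :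
    conjDirac D (ω : H →L[ℂ] H) hωD x =
      (ω : H →L[ℂ] H) (D ⟨(ω : H →L[ℂ] H) x, (hωD x).2 x.2⟩) := rfl

/-- `ωDω` is symmetric because `ω` and `D` are; only the domain of the adjoint needs an argument,
and there the invertibility of `ω` enters. -/
theorem isSelfAdjoint_conjDirac [CompleteSpace H] (hD : IsSelfAdjoint D)
    (hω : (ω : H →L[ℂ] H).IsPositive)
    (hωD : ∀ x, (ω : H →L[ℂ] H) x ∈ D.domain ↔ x ∈ D.domain) :
    IsSelfAdjoint (conjDirac D (ω : H →L[ℂ] H) hωD) := by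
  have hsym : ∀ x y, inner ℂ ((ω : H →L[ℂ] H) x) y = inner ℂ x ((ω : H →L[ℂ] H) y) :=
    hω.isSymmetric
  have hd : Dense ((conjDirac D (ω : H →L[ℂ] H) hωD).domain : Set H) := hD.dense_domain
  have hDf : D.IsFormalAdjoint D := by
    have h := LinearPMap.adjoint_isFormalAdjoint hD.dense_domain
    rwa [LinearPMap.isSelfAdjoint_def.1 hD] at h
  have hf : (conjDirac D (ω : H →L[ℂ] H) hωD).IsFormalAdjoint
      (conjDirac D (ω : H →L[ℂ] H) hωD) := fun x y => by
    rw [conjDirac_coe_apply, conjDirac_coe_apply, hsym]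
    exact (hDf ⟨_, (hωD x).2 x.2⟩ ⟨_, (hωD y).2 y.2⟩).trans (hsym _ _)
  rw [LinearPMap.isSelfAdjoint_def]
  refine (LinearPMap.eq_of_le_of_domain_eq (hf.le_adjoint hd) ?_).symm
  refine le_antisymm (hf.le_adjoint hd).1 fun y hy => ?_
  refine (hωD y).1 ?_
  rw [← LinearPMap.isSelfAdjoint_def.1 hD]
  let w := (conjDirac D (ω : H →L[ℂ] H) hωD).adjoint ⟨y, hy⟩
  -- From `⟨w, z⟩ = ⟨y, ωDωz⟩` with `z = ω⁻¹x` follows `⟨ω⁻¹w, x⟩ = ⟨ωy, Dx⟩`, so `ω⁻¹w` witnesses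
  -- that `ωy` lies in the domain of `D* = D`.
  refine LinearPMap.mem_adjoint_domain_of_exists _
    ⟨((ω⁻¹ : (H →L[ℂ] H)ˣ) : H →L[ℂ] H) w, fun x => ?_⟩
  have hx : ((ω⁻¹ : (H →L[ℂ] H)ˣ) : H →L[ℂ] H) x ∈ D.domain := by
    rw [← hωD, unit_apply_inv_apply]
    exact x.2
  have h1 : (ω : H →L[ℂ] H) (D x) = conjDirac D (ω : H →L[ℂ] H) hωD ⟨_, hx⟩ :=
    congrArg (fun z => (ω : H →L[ℂ] H) (D z)) (Subtype.ext (unit_apply_inv_apply ω _).symm)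
  rw [hsym, h1, ← LinearPMap.adjoint_isFormalAdjoint hd ⟨y, hy⟩ ⟨_, hx⟩]
  conv_lhs => rw [← unit_apply_inv_apply ω x, ← hsym, unit_apply_inv_apply]

theorem inner_apply_self_im [CompleteSpace H] (hD : IsSelfAdjoint D) (x : D.domain) :
    (inner ℂ (x : H) (D x)).im = 0 := by
  have h := LinearPMap.adjoint_isFormalAdjoint hD.dense_domain
  rw [LinearPMap.isSelfAdjoint_def.1 hD] at h
  rw [← Complex.conj_eq_iff_im, inner_conj_symm]
  exact h x x

/-- Fredholm alternative at the value `-1`: either it is an eigenvalue of `K`, excluded by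
injectivity, or it lies in the resolvent set. -/
theorem isUnit_one_add_of_isCompactOperator {E : Type*} [NormedAddCommGroup E] [NormedSpace ℂ E]
    [CompleteSpace E] {K : E →L[ℂ] E} (hK : IsCompactOperator K)
    (h : ∀ x, x + K x = 0 → x = 0) : IsUnit (1 + K) := by
  obtain h' | h' := hK.hasEigenvalue_or_mem_resolventSet (μ := -1) (by simp)
  · obtain ⟨v, hv⟩ := h'.exists_hasEigenvector
    refine absurd (h v ?_) hv.2
    have : K v = (-1 : ℂ) • v := hv.apply_eq_smul
    simp [this]
  · rw [spectrum.mem_resolventSet_iff, ← IsUnit.neg_iff] at h'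
    convert h' using 1
    simp [Algebra.algebraMap_eq_smul_one, add_comm]

/-- `ωDω + i = ω(D + iω⁻²)ω`, and `D + iω⁻²` differs from `D + i` by a bounded, hence relatively
compact, operator. Its bijectivity thus reduces to injectivity, which positivity of `ω⁻²` provides.
-/
theorem hasCompactResolvent_conjDirac [CompleteSpace H] (hD : IsSelfAdjoint D)
    (hres : HasCompactResolvent D) (hω : (ω : H →L[ℂ] H).IsPositive)
    (hωD : ∀ x, (ω : H →L[ℂ] H) x ∈ D.domain ↔ x ∈ D.domain) :
    HasCompactResolvent (conjDirac D (ω : H →L[ℂ] H) hωD) := by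
  obtain ⟨R, hR, hRD, hDR⟩ := hres
  have hsym : ∀ x y, inner ℂ ((ω : H →L[ℂ] H) x) y = inner ℂ x ((ω : H →L[ℂ] H) y) :=
    hω.isSymmetric
  let W : H →L[ℂ] H := ((ω⁻¹ : (H →L[ℂ] H)ˣ) : H →L[ℂ] H)
  have hωW : ∀ x, (ω : H →L[ℂ] H) (W x) = x := unit_apply_inv_apply ω
  have hWω : ∀ x, W ((ω : H →L[ℂ] H) x) = x := unit_inv_apply_apply ω
  have hWD : ∀ x, W x ∈ D.domain ↔ x ∈ D.domain := fun x => by rw [← hωD, hωW]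
  -- `(D + i ω⁻²) (D + i)⁻¹ = 1 + C`
  let C : H →L[ℂ] H := (Complex.I • (W ∘L W) - Complex.I • ContinuousLinearMap.id ℂ H) ∘L R
  have hC : IsCompactOperator C :=
    hR.clm_comp (Complex.I • (W ∘L W) - Complex.I • ContinuousLinearMap.id ℂ H)
  have hCapp : ∀ y, C y = Complex.I • W (W (R y)) - Complex.I • R y := fun y => rfl
  have hC1 : ∀ y (h : R y ∈ D.domain), y + C y = D ⟨R y, h⟩ + Complex.I • W (W (R y)) := by
    intro y h
    have h1 := (hRD y).2
    rw [hCapp]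
    nth_rw 1 [← h1]
    abel
  -- If `(D + iω⁻²)v = 0` with `v = Ry`, then `⟨v, Dv⟩ = -i‖ω⁻¹v‖²` is real, which forces `v = 0`.
  have hinj : ∀ y, y + C y = 0 → y = 0 := by
    intro y hy
    obtain ⟨h, h'⟩ := hRD y
    rw [hC1 y h] at hy
    have h1 := inner_apply_self_im hD ⟨R y, h⟩
    have h2 : inner ℂ (R y) (W (W (R y))) = inner ℂ (W (R y)) (W (R y)) := by
      conv_lhs => rw [← hωW (R y), hsym, hωW, hWω]
    rw [eq_neg_of_add_eq_zero_left hy, inner_neg_right, inner_smul_right, h2,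
      inner_self_eq_norm_sq_to_K] at h1
    have h3 : W (R y) = 0 := by
      simpa [← Complex.ofReal_pow] using h1
    have h4 : R y = 0 := by rw [← hωW (R y), h3, map_zero]
    have h5 : (⟨R y, h⟩ : D.domain) = 0 := Subtype.ext h4
    rw [h5, D.map_zero, h4, smul_zero, add_zero] at h'
    exact h'.symm
  obtain ⟨U, hU⟩ := isUnit_one_add_of_isCompactOperator hC hinj
  have hUapp : ∀ y, (U : H →L[ℂ] H) y = y + C y := fun y => by rw [hU]; rfl
  let V : H →L[ℂ] H := ((U⁻¹ : (H →L[ℂ] H)ˣ) : H →L[ℂ] H)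
  have hUV : ∀ y, V y + C (V y) = y := fun y => by
    rw [← hUapp]; exact unit_apply_inv_apply U y
  -- `(ωDω + i)⁻¹ = ω⁻¹(D + iω⁻²)⁻¹ω⁻¹`, where `D + iω⁻² = (1 + C)(D + i)` on `dom D`.
  refine ⟨W ∘L R ∘L V ∘L W, ?_, ?_, ?_⟩
  · exact (hR.comp_clm (V ∘L W)).clm_comp W
  · intro y
    obtain ⟨h, -⟩ := hRD (V (W y))
    have hz := hC1 _ h
    rw [hUV] at hz
    refine ⟨(hWD _).2 h, ?_⟩
    have h1 : D ⟨_, (hωD _).2 ((hWD (R (V (W y)))).2 h)⟩ = D ⟨_, h⟩ := by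
      congr 1
      exact Subtype.ext (hωW _)
    have h2 := congrArg (ω : H →L[ℂ] H) hz
    rw [hωW, map_add, map_smul, hωW] at h2
    exact (congrArg (fun v => (ω : H →L[ℂ] H) v + Complex.I • W (R (V (W y)))) h1).trans h2.symm
  · intro x
    let v : D.domain := ⟨(ω : H →L[ℂ] H) x, (hωD x).2 x.2⟩
    have hv := hDR v
    have hR' : R (D v + Complex.I • (v : H)) ∈ D.domain := by
      rw [hv]
      exact v.2
    have h1 := hC1 _ hR'
    have h2 : D ⟨_, hR'⟩ = D v := by
      congr 1
      exact Subtype.ext hv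
    rw [h2, hv] at h1
    have h3 : W (conjDirac D (ω : H →L[ℂ] H) hωD x + Complex.I • (x : H)) =
        D v + Complex.I • W (W v) := by
      rw [conjDirac_coe_apply, map_add, map_smul, hWω]
      exact congrArg (fun z => D v + Complex.I • W z) (hWω x).symm
    have h4 : V (D v + Complex.I • W (W v)) = D v + Complex.I • (v : H) := by
      rw [← h1, ← hUapp]
      exact unit_inv_apply_apply U _
    calc W (R (V (W (conjDirac D (ω : H →L[ℂ] H) hωD x + Complex.I • (x : H)))))
        = W v := by rw [h3, h4, hv]
      _ = x := hWω _

variable {S : Submodule ℂ H}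

theorem isOdd_conjDirac (hodd : IsOdd S D) (hω : IsEven S (ω : H →L[ℂ] H))
    (hωD : ∀ x, (ω : H →L[ℂ] H) x ∈ D.domain ↔ x ∈ D.domain) :
    IsOdd S (conjDirac D (ω : H →L[ℂ] H) hωD) where
  domain_splits := hodd.domain_splits
  map_plus x hx := hω.2 _ (hodd.map_plus ⟨_, (hωD x).2 x.2⟩ (hω.1 _ hx))
  map_minus x hx := hω.1 _ (hodd.map_minus ⟨_, (hωD x).2 x.2⟩ (hω.2 _ hx))

variable {A A' : Type*} [Ring A] [Algebra ℂ A] [Ring A'] [Algebra ℂ A']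
  {π : A →ₐ[ℂ] (H →L[ℂ] H)} {π' : A' →ₐ[ℂ] (H →L[ℂ] H)}

/-- On `dom D ∩ S`, the twisted commutator of `ω D ω` with `a` is `ω [D, g a g⁻¹] ω`. -/
theorem conjDirac_twisted_commutator (hodd : IsOdd S D) (hω : IsEven S (ω : H →L[ℂ] H))
    (hωD : ∀ x, (ω : H →L[ℂ] H) x ∈ D.domain ↔ x ∈ D.domain) {g g' : Aˣ}
    (htw : ∀ b, ∀ x ∈ S, (ω : H →L[ℂ] H) (π b x) = π (g * b * (g⁻¹ : Aˣ)) ((ω : H →L[ℂ] H) x))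
    (htw' : ∀ b, ∀ x ∈ Sᗮ,
      (ω : H →L[ℂ] H) (π b x) = π (g' * b * (g'⁻¹ : Aˣ)) ((ω : H →L[ℂ] H) x))
    {a a' : A} (ha' : a' = g' * (g * a * (g⁻¹ : Aˣ)) * (g'⁻¹ : Aˣ)) {C : H →L[ℂ] H}
    (hC : IsCommutator D (π (g * a * (g⁻¹ : Aˣ))) C) (x : D.domain) (hx : (x : H) ∈ S)
    (h : π a x ∈ D.domain) :
    conjDirac D (ω : H →L[ℂ] H) hωD ⟨π a x, h⟩ -
      π a' (conjDirac D (ω : H →L[ℂ] H) hωD x) =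
        (ω : H →L[ℂ] H) (C ((ω : H →L[ℂ] H) x)) := by
  have hωx : (ω : H →L[ℂ] H) x ∈ D.domain := (hωD x).2 x.2
  obtain ⟨h1, h2⟩ := hC ⟨_, hωx⟩
  have h3 : D ⟨(ω : H →L[ℂ] H) (π a x), (hωD _).2 h⟩ = D ⟨_, h1⟩ := by
    congr 1
    exact Subtype.ext (htw a x hx)
  have h4 : (ω : H →L[ℂ] H) (π (g * a * (g⁻¹ : Aˣ)) (D ⟨_, hωx⟩)) =
      π a' ((ω : H →L[ℂ] H) (D ⟨_, hωx⟩)) := by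
    rw [htw' _ _ (hodd.map_plus ⟨_, hωx⟩ (hω.1 _ hx)), ha']
  have h5 : conjDirac D (ω : H →L[ℂ] H) hωD ⟨π a x, h⟩ =
      (ω : H →L[ℂ] H) (D ⟨(ω : H →L[ℂ] H) (π a x), (hωD _).2 h⟩) := rfl
  rw [h5, conjDirac_apply, h3, h2, map_add, h4, add_sub_cancel_left]

/-- Moving `a` leftwards through `ωCω`: the right `ω` acts on `S` and conjugates by `g`, `C`
commutes with the representation, and the left `ω` acts on `Sᗮ` and conjugates by `g'`. With `C` a
commutator coming from the other algebra, this is the vanishing of the twisted double commutator on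
`S`. -/
theorem twist_comp_commutator (hodd : IsOdd S D) (hω : IsEven S (ω : H →L[ℂ] H))
    (hωD : ∀ x, (ω : H →L[ℂ] H) x ∈ D.domain ↔ x ∈ D.domain) {g g' : A'ˣ}
    (htw : ∀ b, ∀ x ∈ S,
      (ω : H →L[ℂ] H) (π' b x) = π' (g * b * (g⁻¹ : A'ˣ)) ((ω : H →L[ℂ] H) x))
    (htw' : ∀ b, ∀ x ∈ Sᗮ,
      (ω : H →L[ℂ] H) (π' b x) = π' (g' * b * (g'⁻¹ : A'ˣ)) ((ω : H →L[ℂ] H) x))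
    {a a' : A'} (ha' : a' = g' * (g * a * (g⁻¹ : A'ˣ)) * (g'⁻¹ : A'ˣ))
    {T C : H →L[ℂ] H} (hT : IsEven S T) (hC : IsCommutator D T C)
    (hCπ : ∀ b, ∀ z ∈ D.domain, C (π' b z) = π' b (C z)) {x : H} (hxD : x ∈ D.domain)
    (hx : x ∈ S) :
    (ω : H →L[ℂ] H) (C ((ω : H →L[ℂ] H) (π' a x))) =
      π' a' ((ω : H →L[ℂ] H) (C ((ω : H →L[ℂ] H) x))) := by
  have hωx : (ω : H →L[ℂ] H) x ∈ D.domain := (hωD x).2 hxD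
  have hωS := hω.1 x hx
  obtain ⟨h1, h2⟩ := hC ⟨_, hωx⟩
  -- The commutator of an odd operator with an even one is odd.
  have hCS : C ((ω : H →L[ℂ] H) x) ∈ Sᗮ := by
    rw [← sub_eq_of_eq_add' h2]
    exact Sᗮ.sub_mem (hodd.map_plus _ (hT.1 _ hωS)) (hT.2 _ (hodd.map_plus _ hωS))
  rw [htw a x hx, hCπ _ _ hωx, htw' _ _ hCS, ha']

end ConjDirac

/-! ### Inner automorphisms and the involution -/

section InnerAut

variable {A : Type*} [Ring A] [Algebra ℂ A]

theorem innerAut_mul_apply (k k' : Aˣ) (a : A) :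
    innerAut (k * k') a = k * (k' * a * (k'⁻¹ : Aˣ)) * (k⁻¹ : Aˣ) := by
  change ((k * k' : Aˣ) : A) * a * ((k * k')⁻¹ : Aˣ) = _
  simp [mul_assoc]

theorem star_innerAut [StarRing A] {k : Aˣ} (hk : IsSelfAdjoint (k : A)) (a : A) :
    star (innerAut k a) = (innerAut k).symm (star a) := by
  have h1 : star k = k := Units.ext hk
  have h2 : star ((k⁻¹ : Aˣ) : A) = (k⁻¹ : Aˣ) := by
    rw [← Units.coe_star_inv, h1]
  change star ((k : A) * a * (k⁻¹ : Aˣ)) = (k⁻¹ : Aˣ) * star a * k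
  rw [star_mul, star_mul, h2, hk.star_eq, mul_assoc]

end InnerAut

/-! ### The twisted triple over a single algebra -/

section Triple

variable {H : Type*} [NormedAddCommGroup H] [InnerProductSpace ℂ H] [CompleteSpace H]
  {Hp : Submodule ℂ H} {D : H →ₗ.[ℂ] H} {ω : (H →L[ℂ] H)ˣ}
  {A : Type*} [Ring A] [Algebra ℂ A] [StarRing A] [StarModule ℂ A]
  {π : A →⋆ₐ[ℂ] (H →L[ℂ] H)} {kp km : Aˣ}

theorem IsPseudoInnerTwisting.apply_plus (h : IsPseudoInnerTwisting Hp π D ω kp km) (a : A) {x : H}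
    (hx : x ∈ Hp) :
    (ω : H →L[ℂ] H) (π a x) = π (kp * a * (kp⁻¹ : Aˣ)) ((ω : H →L[ℂ] H) x) := by
  rw [← h.twist_plus a _ (h.even.1 x hx)]
  simp only [mul_apply_eq_comp, unit_inv_apply_apply]

theorem IsPseudoInnerTwisting.apply_minus (h : IsPseudoInnerTwisting Hp π D ω kp km) (a : A) {x : H}
    (hx : x ∈ Hpᗮ) :
    (ω : H →L[ℂ] H) (π a x) = π (km * a * (km⁻¹ : Aˣ)) ((ω : H →L[ℂ] H) x) := by
  rw [← h.twist_minus a _ (h.even.2 x hx)]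
  simp only [mul_apply_eq_comp, unit_inv_apply_apply]

theorem IsSpectralTriple.exists_isCommutator (ht : IsSpectralTriple Hp π D) (a : A) :
    ∃ C : H →L[ℂ] H, IsCommutator D (π a) C := by
  obtain ⟨c, hc⟩ := ht.bounded_twisted_commutator a
  exact TwistedPD.exists_isCommutator ht.selfAdjoint.dense_domain (ht.preserves_domain a) hc

variable [Hp.HasOrthogonalProjection]

/-- The twisted commutators of `ω D ω` with `a ∈ A`, in terms of bounded extensions of the
commutators of `D` with `k⁺ a (k⁺)⁻¹` and `k⁻ a (k⁻)⁻¹`. -/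
theorem IsPseudoInnerTwisting.twisted_commutator (h : IsPseudoInnerTwisting Hp π D ω kp km)
    (hodd : IsOdd Hp D) (hdom : ∀ a, ∀ x ∈ D.domain, π a x ∈ D.domain)
    (hωD : ∀ x, (ω : H →L[ℂ] H) x ∈ D.domain ↔ x ∈ D.domain) {a : A}
    {Cp Cm : H →L[ℂ] H} (hCp : IsCommutator D (π (kp * a * (kp⁻¹ : Aˣ))) Cp)
    (hCm : IsCommutator D (π (km * a * (km⁻¹ : Aˣ))) Cm) (x : D.domain) (hx : π a x ∈ D.domain) :
    conjDirac D (ω : H →L[ℂ] H) hωD ⟨π a x, hx⟩ -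
      π (innerAut (kp * km) a) (conjDirac D (ω : H →L[ℂ] H) hωD x) =
        (ω : H →L[ℂ] H) (Cp ((ω : H →L[ℂ] H) (Hp.starProjection x))) +
          (ω : H →L[ℂ] H) (Cm ((ω : H →L[ℂ] H) (Hpᗮ.starProjection x))) := by
  let D' := conjDirac D (ω : H →L[ℂ] H) hωD
  have hu : Hp.starProjection x ∈ D.domain := (hodd.starProjection x).1
  have hv : Hpᗮ.starProjection x ∈ D.domain := (hodd.orthogonal.starProjection x).1
  have h1 : D' ⟨_, hdom a _ hu⟩ - π (innerAut (kp * km) a) (D' ⟨_, hu⟩) =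
      (ω : H →L[ℂ] H) (Cp ((ω : H →L[ℂ] H) (Hp.starProjection x))) :=
    conjDirac_twisted_commutator (π := π.toAlgHom) hodd h.even hωD (fun b x hx => h.apply_plus b hx) (fun b x hx => h.apply_minus b hx)
    (h.commute ▸ innerAut_mul_apply km kp a) hCp ⟨_, hu⟩ (Hp.starProjection_apply_mem _)
    (hdom a _ hu)
  have h2 : D' ⟨_, hdom a _ hv⟩ - π (innerAut (kp * km) a) (D' ⟨_, hv⟩) =
      (ω : H →L[ℂ] H) (Cm ((ω : H →L[ℂ] H) (Hpᗮ.starProjection x))) :=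
    conjDirac_twisted_commutator (π := π.toAlgHom) hodd.orthogonal h.even.orthogonal hωD (fun b x hx => h.apply_minus b hx)
    (fun b x hx => h.apply_plus b (by rwa [Submodule.orthogonal_orthogonal] at hx))
    (innerAut_mul_apply kp km a) hCm ⟨_, hv⟩ (Hpᗮ.starProjection_apply_mem _)
    (hdom a _ hv)
  have e1 : D' x = D' ⟨_, hu⟩ + D' ⟨_, hv⟩ := by
    rw [← D'.map_add]
    exact congrArg D' (Subtype.ext (eq_starProjection_add Hp (x : H)))
  have e2 : D' ⟨π a x, hx⟩ = D' ⟨_, hdom a _ hu⟩ + D' ⟨_, hdom a _ hv⟩ := by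
    rw [← D'.map_add]
    refine congrArg D' (Subtype.ext ?_)
    change π a x = π a (Hp.starProjection x) + π a (Hpᗮ.starProjection x)
    rw [← map_add, ← eq_starProjection_add]
  rw [← h1, ← h2]
  change D' ⟨π a x, hx⟩ - π _ (D' x) = _
  rw [e1, e2, map_add]
  abel

theorem IsPseudoInnerTwisting.isTwistedSpectralTriple (h : IsPseudoInnerTwisting Hp π D ω kp km)
    (ht : IsSpectralTriple Hp π D)
    (hωD : ∀ x, (ω : H →L[ℂ] H) x ∈ D.domain ↔ x ∈ D.domain) :
    IsTwistedSpectralTriple Hp π (conjDirac D (ω : H →L[ℂ] H) hωD) (innerAut (kp * km)) where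
  isClosed_plus := ht.isClosed_plus
  even := ht.even
  star_twist a := by
    refine star_innerAut ?_ a
    -- `k⁺k⁻` is selfadjoint because the two selfadjoint factors commute; this is what compatibility
    -- of `σ` with the involution needs.
    have h1 : (km : A) * kp = kp * km := by
      rw [← Units.val_mul, ← h.commute, Units.val_mul]
    rw [isSelfAdjoint_iff, Units.val_mul, star_mul, h.pos_kp.1.star_eq, h.pos_km.1.star_eq, h1]
  odd := isOdd_conjDirac ht.odd h.even hωD
  selfAdjoint := isSelfAdjoint_conjDirac ht.selfAdjoint h.positive hωD
  compactResolvent := hasCompactResolvent_conjDirac ht.selfAdjoint ht.compactResolvent h.positive hωD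
  preserves_domain := ht.preserves_domain
  bounded_twisted_commutator a := by
    obtain ⟨Cp, hCp⟩ := ht.exists_isCommutator (kp * a * (kp⁻¹ : Aˣ))
    obtain ⟨Cm, hCm⟩ := ht.exists_isCommutator (km * a * (km⁻¹ : Aˣ))
    let J : H →L[ℂ] H := (ω : H →L[ℂ] H) ∘L Cp ∘L (ω : H →L[ℂ] H) ∘L Hp.starProjection +
      (ω : H →L[ℂ] H) ∘L Cm ∘L (ω : H →L[ℂ] H) ∘L Hpᗮ.starProjection
    refine ⟨‖J‖, fun x hx => ?_⟩
    rw [h.twisted_commutator ht.odd ht.preserves_domain hωD hCp hCm x hx]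
    exact J.le_opNorm x

end Triple

/-! ### Poincaré duality of the twisted spectral triples -/

/-- An additive map representing one index represents the other; if there is none, both index maps
take the default value `0`. So existence of the index map need not be proved. -/
theorem indexMap_congr {H : Type*} [NormedAddCommGroup H] [InnerProductSpace ℂ H]
    {B : Type*} [Ring B] [Algebra ℂ B] {Hp : Submodule ℂ H} {π : B →ₐ[ℂ] (H →L[ℂ] H)}
    {D D' : H →ₗ.[ℂ] H} {σ σ' : B ≃ₐ[ℂ] B}
    (h : ∀ e : IdemMat B, diracIndex Hp π D σ e.mat = diracIndex Hp π D' σ' e.mat) :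
    indexMap Hp π D σ = indexMap Hp π D' σ' := by
  by_cases h0 : ∃ f : K0 B →+ ℚ, ∀ e : IdemMat B, f (K0.cls e) = diracIndex Hp π D σ e.mat
  · obtain ⟨f, hf⟩ := h0
    rw [indexMap_eq hf, indexMap_eq fun e => (hf e).trans (h e)]
  · have h0' : ¬∃ f : K0 B →+ ℚ, ∀ e : IdemMat B, f (K0.cls e) = diracIndex Hp π D' σ' e.mat := by
      simpa only [h] using h0
    rw [indexMap, indexMap, dif_neg h0, dif_neg h0']

/-- The tensor product of two units. -/
def tensorUnit {A₁ A₂ : Type*} [Ring A₁] [Algebra ℂ A₁] [Ring A₂] [Algebra ℂ A₂] (a : A₁ˣ)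
    (b : A₂ˣ) : (A₁ ⊗[ℂ] A₂)ˣ where
  val := (a : A₁) ⊗ₜ (b : A₂)
  inv := ((a⁻¹ : A₁ˣ) : A₁) ⊗ₜ ((b⁻¹ : A₂ˣ) : A₂)
  val_inv := by simp [Algebra.TensorProduct.one_def]
  inv_val := by simp [Algebra.TensorProduct.one_def]

theorem tensorUnit_mul_eq_congr_innerAut {A₁ A₂ : Type*} [Ring A₁] [Algebra ℂ A₁] [Ring A₂]
    [Algebra ℂ A₂] {k₁ g₁ g₁' : A₁ˣ} {k₂ g₂ g₂' : A₂ˣ}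
    (h₁ : g₁' * g₁ = k₁) (h₂ : g₂' * g₂ = k₂) (b : A₁ ⊗[ℂ] A₂) :
    (tensorUnit g₁' g₂').val * (tensorUnit g₁ g₂).val * b =
      Algebra.TensorProduct.congr (innerAut k₁) (innerAut k₂) b *
        ((tensorUnit g₁' g₂').val * (tensorUnit g₁ g₂).val) := by
  have hk : (tensorUnit g₁' g₂').val *
      (tensorUnit g₁ g₂).val = (k₁ : A₁) ⊗ₜ (k₂ : A₂) := by
    change ((g₁' : A₁) ⊗ₜ[ℂ] (g₂' : A₂)) * ((g₁ : A₁) ⊗ₜ[ℂ] (g₂ : A₂)) = _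
    rw [Algebra.TensorProduct.tmul_mul_tmul, ← h₁, ← h₂, Units.val_mul, Units.val_mul]
  rw [hk]
  induction b using TensorProduct.induction_on with
  | zero => simp
  | tmul a₁ a₂ =>
    have h : Algebra.TensorProduct.congr (innerAut k₁) (innerAut k₂) (a₁ ⊗ₜ[ℂ] a₂) =
        ((k₁ : A₁) * a₁ * (k₁⁻¹ : A₁ˣ)) ⊗ₜ ((k₂ : A₂) * a₂ * (k₂⁻¹ : A₂ˣ)) := rfl
    rw [h, Algebra.TensorProduct.tmul_mul_tmul, Algebra.TensorProduct.tmul_mul_tmul,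
      Units.inv_mul_cancel_right, Units.inv_mul_cancel_right]
  | add y z hy hz => rw [mul_add, map_add, add_mul, hy, hz]

section Duality

variable {H : Type*} [NormedAddCommGroup H] [InnerProductSpace ℂ H] [CompleteSpace H]
  {A₁ A₂ : Type*} [Ring A₁] [Algebra ℂ A₁] [StarRing A₁]
  [Ring A₂] [Algebra ℂ A₂] [StarRing A₂]
  {Hp : Submodule ℂ H} {π₁ : A₁ →⋆ₐ[ℂ] (H →L[ℂ] H)} {π₂ : A₂ →⋆ₐ[ℂ] (H →L[ℂ] H)}
  {D : H →ₗ.[ℂ] H}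

theorem tensorRep_tmul (hc : ∀ a₁ a₂, Commute (π₁ a₁) (π₂ a₂)) (a₁ : A₁) (a₂ : A₂) :
    tensorRep π₁ π₂ hc (a₁ ⊗ₜ a₂) = π₁ a₁ * π₂ a₂ := by
  simp [tensorRep]

theorem isEven_tensorRep (hc : ∀ a₁ a₂, Commute (π₁ a₁) (π₂ a₂)) (h₁ : ∀ a, IsEven Hp (π₁ a))
    (h₂ : ∀ a, IsEven Hp (π₂ a)) (b : A₁ ⊗[ℂ] A₂) : IsEven Hp (tensorRep π₁ π₂ hc b) := by
  induction b using TensorProduct.induction_on with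
  | zero => simp [IsEven]
  | tmul a₁ a₂ =>
    rw [tensorRep_tmul]
    exact (h₁ a₁).mul (h₂ a₂)
  | add x y hx hy =>
    rw [map_add]
    exact hx.add hy

/-- By the Leibniz rule on elementary tensors and additivity. -/
theorem exists_isCommutator_tensorRep (hc : ∀ a₁ a₂, Commute (π₁ a₁) (π₂ a₂))
    (h₁ : ∀ a, ∃ C : H →L[ℂ] H, IsCommutator D (π₁ a) C)
    (h₂ : ∀ a, ∃ C : H →L[ℂ] H, IsCommutator D (π₂ a) C) (b : A₁ ⊗[ℂ] A₂) :
    ∃ C : H →L[ℂ] H, IsCommutator D (tensorRep π₁ π₂ hc b) C := by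
  induction b using TensorProduct.induction_on with
  | zero =>
    rw [map_zero]
    exact ⟨0, fun x => ⟨D.domain.zero_mem, D.map_zero.trans (by simp)⟩⟩
  | tmul a₁ a₂ =>
    obtain ⟨C₁, hC₁⟩ := h₁ a₁
    obtain ⟨C₂, hC₂⟩ := h₂ a₂
    rw [tensorRep_tmul]
    exact ⟨_, hC₁.mul hC₂⟩
  | add x y hx hy =>
    obtain ⟨C, hC⟩ := hx
    obtain ⟨C', hC'⟩ := hy
    rw [map_add]
    exact ⟨_, hC.add hC'⟩

/-- On elementary tensors, `ω` passes `a₁` and then `a₂`; the first move is allowed because `a₂x` is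
still in `S`. Thus `ω` twists the tensor product by `g₁ ⊗ g₂`. -/
theorem tensorRep_twist (hc : ∀ a₁ a₂, Commute (π₁ a₁) (π₂ a₂)) {S : Submodule ℂ H}
    {ω : H →L[ℂ] H} {g₁ : A₁ˣ} {g₂ : A₂ˣ} (h₂ : ∀ a, ∀ x ∈ S, π₂ a x ∈ S)
    (htw₁ : ∀ a, ∀ x ∈ S, ω (π₁ a x) = π₁ (g₁ * a * (g₁⁻¹ : A₁ˣ)) (ω x))
    (htw₂ : ∀ a, ∀ x ∈ S, ω (π₂ a x) = π₂ (g₂ * a * (g₂⁻¹ : A₂ˣ)) (ω x))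
    (b : A₁ ⊗[ℂ] A₂) (x : H) (hx : x ∈ S) :
    ω (tensorRep π₁ π₂ hc b x) = tensorRep π₁ π₂ hc
      ((tensorUnit g₁ g₂).val * b * (tensorUnit g₁ g₂)⁻¹.val) (ω x) := by
  induction b using TensorProduct.induction_on with
  | zero => simp
  | tmul a₁ a₂ =>
    have h : (tensorUnit g₁ g₂).val * a₁ ⊗ₜ[ℂ] a₂ *
        (tensorUnit g₁ g₂)⁻¹.val =
        ((g₁ : A₁) * a₁ * (g₁⁻¹ : A₁ˣ)) ⊗ₜ ((g₂ : A₂) * a₂ * (g₂⁻¹ : A₂ˣ)) := by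
      change ((g₁ : A₁) ⊗ₜ[ℂ] (g₂ : A₂)) * a₁ ⊗ₜ[ℂ] a₂ *
        (((g₁⁻¹ : A₁ˣ) : A₁) ⊗ₜ[ℂ] ((g₂⁻¹ : A₂ˣ) : A₂)) = _
      rw [Algebra.TensorProduct.tmul_mul_tmul, Algebra.TensorProduct.tmul_mul_tmul]
    rw [h, tensorRep_tmul, tensorRep_tmul, mul_apply_eq_comp, mul_apply_eq_comp,
      htw₁ _ _ (h₂ a₂ x hx), htw₂ _ _ hx]
  | add y z hy hz => rw [mul_add, add_mul, map_add, map_add, add_apply, add_apply, map_add, hy, hz]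

variable [StarModule ℂ A₁] [StarModule ℂ A₂] {ω : (H →L[ℂ] H)ˣ} {kp₁ km₁ : A₁ˣ}
  {kp₂ km₂ : A₂ˣ} [Hp.HasOrthogonalProjection]

/-- The index map of the twisted triple defined by `ω D ω` is that of the ordinary triple. -/
theorem indexMap_conjDirac (hc : ∀ a₁ a₂, Commute (π₁ a₁) (π₂ a₂)) (ht₁ : IsSpectralTriple Hp π₁ D)
    (ht₂ : IsSpectralTriple Hp π₂ D) (h₁ : IsPseudoInnerTwisting Hp π₁ D ω kp₁ km₁)
    (h₂ : IsPseudoInnerTwisting Hp π₂ D ω kp₂ km₂)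
    (hωD : ∀ x, (ω : H →L[ℂ] H) x ∈ D.domain ↔ x ∈ D.domain) :
    indexMap Hp (tensorRep π₁ π₂ hc) (conjDirac D (ω : H →L[ℂ] H) hωD)
      (Algebra.TensorProduct.congr (innerAut (kp₁ * km₁)) (innerAut (kp₂ * km₂))) =
    indexMap Hp (tensorRep π₁ π₂ hc) D
      (Algebra.TensorProduct.congr AlgEquiv.refl AlgEquiv.refl) := by
  refine indexMap_congr fun e => ?_
  have hev := isEven_tensorRep hc ht₁.even ht₂.even
  have hC := exists_isCommutator_tensorRep hc ht₁.exists_isCommutator ht₂.exists_isCommutator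
  have htp := tensorRep_twist hc (fun a => (ht₂.even a).1) (fun a x hx => h₁.apply_plus a hx)
    (fun a x hx => h₂.apply_plus a hx)
  have htm := tensorRep_twist hc (fun a => (ht₂.even a).2) (fun a x hx => h₁.apply_minus a hx)
    (fun a x hx => h₂.apply_minus a hx)
  have hp := chiralIndex_conjDirac ht₁.odd ht₁.compactResolvent hev hC h₁.even hωD
    (tensorUnit_mul_eq_congr_innerAut h₁.commute.symm h₂.commute.symm) htp htm e.idem
  -- On `H⁻` the units `k⁺` and `k⁻` exchange roles, so the product appears in the order `k⁺k⁻` that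
  -- defines `σ`; on `H⁺` the commutation of the two was needed.
  have hm := chiralIndex_conjDirac ht₁.odd.orthogonal ht₁.compactResolvent
    (fun b => (hev b).orthogonal) hC h₁.even.orthogonal hωD
    (tensorUnit_mul_eq_congr_innerAut (Eq.refl (kp₁ * km₁)) (Eq.refl (kp₂ * km₂))) htm
    (by rw [Submodule.orthogonal_orthogonal]; exact htp) e.idem
  rw [Submodule.orthogonal_orthogonal] at hm
  rw [Algebra.TensorProduct.congr_refl, diracIndex, diracIndex, hp, hm]

theorem IsPseudoInnerTwisting.order_one (hPD : InOrdinaryPoincareDuality Hp π₁ π₂ D)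
    (h₁ : IsPseudoInnerTwisting Hp π₁ D ω kp₁ km₁) (h₂ : IsPseudoInnerTwisting Hp π₂ D ω kp₂ km₂)
    (hωD : ∀ x, (ω : H →L[ℂ] H) x ∈ D.domain ↔ x ∈ D.domain) (a₁ : A₁) (a₂ : A₂)
    (x : (conjDirac D (ω : H →L[ℂ] H) hωD).domain)
    (hx₁ : π₁ a₁ x ∈ (conjDirac D (ω : H →L[ℂ] H) hωD).domain)
    (hx₂ : π₂ a₂ x ∈ (conjDirac D (ω : H →L[ℂ] H) hωD).domain)
    (hx₁₂ : π₁ a₁ (π₂ a₂ x) ∈ (conjDirac D (ω : H →L[ℂ] H) hωD).domain) :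
    (conjDirac D (ω : H →L[ℂ] H) hωD ⟨π₁ a₁ (π₂ a₂ x), hx₁₂⟩ -
        π₁ (innerAut (kp₁ * km₁) a₁) (conjDirac D (ω : H →L[ℂ] H) hωD ⟨π₂ a₂ x, hx₂⟩)) -
      π₂ (innerAut (kp₂ * km₂) a₂) (conjDirac D (ω : H →L[ℂ] H) hωD ⟨π₁ a₁ x, hx₁⟩ -
        π₁ (innerAut (kp₁ * km₁) a₁) (conjDirac D (ω : H →L[ℂ] H) hωD x)) = 0 := by
  have ht₁ : IsSpectralTriple Hp π₁ D := hPD.triple₁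
  have ht₂ : IsSpectralTriple Hp π₂ D := hPD.triple₂
  have hodd := ht₁.odd
  -- The untwisted order one condition says that the bounded extension of `[D, b]` commutes with
  -- `A₂` on `dom D`.
  have hcomm : ∀ (b : A₁) (C : H →L[ℂ] H), IsCommutator D (π₁ b) C →
      ∀ b', ∀ z ∈ D.domain, C (π₂ b' z) = π₂ b' (C z) := by
    intro b C hC b' z hz
    have hz₂ := ht₂.preserves_domain b' z hz
    obtain ⟨h3, h4⟩ := hC ⟨_, hz₂⟩
    obtain ⟨h5, h6⟩ := hC ⟨z, hz⟩
    have h7 := hPD.order_one b b' ⟨z, hz⟩ h5 hz₂ h3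
    rw [← sub_eq_of_eq_add' h4, ← sub_eq_of_eq_add' h6]
    exact sub_eq_zero.1 h7
  obtain ⟨Cp, hCp⟩ := ht₁.exists_isCommutator (kp₁ * a₁ * (kp₁⁻¹ : A₁ˣ))
  obtain ⟨Cm, hCm⟩ := ht₁.exists_isCommutator (km₁ * a₁ * (km₁⁻¹ : A₁ˣ))
  have hu : Hp.starProjection (x : H) ∈ D.domain := (hodd.starProjection x).1
  have hv : Hpᗮ.starProjection (x : H) ∈ D.domain := (hodd.orthogonal.starProjection x).1
  have hp := twist_comp_commutator (π' := π₂.toAlgHom) hodd h₁.even hωD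
    (fun b x hx => h₂.apply_plus b hx) (fun b x hx => h₂.apply_minus b hx)
    (h₂.commute ▸ innerAut_mul_apply km₂ kp₂ a₂) (ht₁.even _) hCp (hcomm _ _ hCp) hu
    (Hp.starProjection_apply_mem _)
  have hm := twist_comp_commutator (π' := π₂.toAlgHom) hodd.orthogonal h₁.even.orthogonal hωD
    (fun b x hx => h₂.apply_minus b hx)
    (fun b x hx => h₂.apply_plus b (by rwa [Submodule.orthogonal_orthogonal] at hx))
    (innerAut_mul_apply kp₂ km₂ a₂) (ht₁.even _).orthogonal hCm (hcomm _ _ hCm) hv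
    (Hpᗮ.starProjection_apply_mem _)
  refine sub_eq_zero.2 ?_
  -- Both terms are expanded by the formula for the twisted commutator, at `π₂ a₂ x` and at `x`, and
  -- then compared separately on the components in `H⁺` and `H⁻`.
  refine (h₁.twisted_commutator hodd ht₁.preserves_domain hωD hCp hCm ⟨π₂ a₂ x, hx₂⟩ hx₁₂).trans ?_
  refine Eq.trans ?_ (congrArg (π₂ (innerAut (kp₂ * km₂) a₂))
    (h₁.twisted_commutator hodd ht₁.preserves_domain hωD hCp hCm x hx₁)).symm
  rw [map_add, ← (ht₂.even a₂).starProjection, ← (ht₂.even a₂).orthogonal.starProjection]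
  exact congrArg₂ (· + ·) hp hm

end Duality

end TwistedPD

theorem mainTheorem9 {H : Type*} [NormedAddCommGroup H] [InnerProductSpace ℂ H] [CompleteSpace H]
    {A₁ A₂ : Type*} [Ring A₁] [Algebra ℂ A₁] [StarRing A₁] [StarModule ℂ A₁]
    [Ring A₂] [Algebra ℂ A₂] [StarRing A₂] [StarModule ℂ A₂]
    (Hp : Submodule ℂ H) (π₁ : A₁ →⋆ₐ[ℂ] (H →L[ℂ] H)) (π₂ : A₂ →⋆ₐ[ℂ] (H →L[ℂ] H))
    (D : H →ₗ.[ℂ] H)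
    (hPD : TwistedPD.InOrdinaryPoincareDuality Hp π₁ π₂ D)
    (ω : (H →L[ℂ] H)ˣ) (kp₁ km₁ : A₁ˣ) (kp₂ km₂ : A₂ˣ)
    (h₁ : TwistedPD.IsPseudoInnerTwisting Hp π₁ D ω kp₁ km₁)
    (h₂ : TwistedPD.IsPseudoInnerTwisting Hp π₂ D ω kp₂ km₂) :
    TwistedPD.InPoincareDuality Hp π₁ π₂
      (TwistedPD.conjDirac D (ω : H →L[ℂ] H) h₁.preserves_domain)
      (TwistedPD.innerAut (kp₁ * km₁)) (TwistedPD.innerAut (kp₂ * km₂)) := by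
  have ht₁ : TwistedPD.IsSpectralTriple Hp π₁ D := hPD.triple₁
  have ht₂ : TwistedPD.IsSpectralTriple Hp π₂ D := hPD.triple₂
  -- Completeness of `H⁺` supplies the orthogonal projections used throughout.
  have : CompleteSpace Hp := ht₁.isClosed_plus.completeSpace_coe
  refine ⟨h₁.isTwistedSpectralTriple ht₁ _, h₂.isTwistedSpectralTriple ht₂ _, hPD.commute,
    h₁.order_one hPD h₂ _, ?_⟩
  have h := TwistedPD.indexMap_conjDirac hPD.commute ht₁ ht₂ h₁ h₂ h₁.preserves_domain
  have hnd := hPD.nondegenerate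
  -- The Dirac operator and the automorphisms enter the pairing only through the index map, so the
  -- two pairings are equal.
  rw [TwistedPD.dualityPairing, ← h] at hnd
  exact hnd
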